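/- Let $A:\mathbb R^d\to\mathbb R^d$ be an expansive dilation, that is, a linear map with $A(\mathbb Z^d)\subseteq\mathbb Z^d$ all of whose complex eigenvalues have modulus $>1$; let $A^*$ be its adjoint, $d_A=|\det A|$ and $\mathcal D_Af(x)=d_A^{1/2}f(Ax)$ on $L^2(\mathbb R^d)$. Write $\widehat f(\xi)=\int f(x)e^{-2\pi i x\cdot\xi}\,dx$ (extended to $L^2$), $\mathrm{Supp}(f)=\{f\ne0\}$, $|\cdot|$ for Lebesgue measure and $B_r$ for the open ball of radius $r$ around $0$. All relations between sets below are meant up to null sets. Let $V\ne\{0\}$ be a closed subspace of $L^2(\mathbb R^d)$ that is shift-invariant ($f\in V$, $k\in\mathbb Z^d$ imply $f(\cdot-k)\in V$) and $A$-refinable ($V\subseteq\mathcal D_AV$). Then $V$ has a tight frame generator, i.e. a family $\{\phi^\alpha\}_{\alpha\in I}\subseteq V$ with $\sum_{\alpha\in I}\sum_{k\in\mathbb Z^d}|\langle f,\phi^\alpha(\cdot-k)\rangle|^2=\|f\|^2$ for all $f\in V$. Let $\sigma_V=\sum_{\alpha\in I}|\widehat{\phi^\alpha}|^2$ be the spectral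 function of $V$, formed with any tight frame generator, and let $G\subseteq\mathbb R^d$ be a measurable set of positive measure with $A^*G=G$ and $\mathrm{Supp}(\sigma_V)\subseteq G$. Put $H^2_G=\{f\in L^2(\mathbb R^d):\mathrm{Supp}(\widehat f)\subseteq G\}$. Then the following conditions are equivalent: 1. $\overline{\bigcup_{j\in\mathbb Z}\mathcal D_A^jV}=H^2_G$; 2. for every set $\mathcal G\subseteq V$ that generates $V$ (the linear span of $\{\phi(\cdot-k):\phi\in\mathcal G,\ k\in\mathbb Z^d\}$ is dense in $V$), $\bigcup_{\phi\in\mathcal G}\bigcup_{j\in\mathbb Z}A^{*j}(\mathrm{Supp}(\widehat\phi))=G$, where for uncountable $\mathcal G$ the union is the essential union (the smallest measurable set, up to null sets, containing all members up to null sets); 3. the equality in 2 holds for some generating set $\mathcal G$ of $V$; 4. for every bounded measurable $E\subseteq G$ of positive measure, $\lim_{j\to\infty}\frac1{|A^{*-j}E|}\int_{A^{*-j}E}\sigma_V(\xi)\,d\xi=1$; 5. $\mathrm{Supp}(\sigma_V)$ is $A^{*-1}$-absorbing in $G$: for a.e. $\xi\in G$ there is a positive integer $j_0$ with $A^{*-j}\xi\in\mathrm{Supp}(\sigma_V)$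 for all $j\ge j_0$; 6. for a.e. $\xi\in G$ the limit $\lim_{j\to\infty}\sigma_V(A^{*-j}\xi)$ exists and is $>0$; 7. $\lim_{j\to\infty}\sigma_V(A^{*-j}\xi)=1$ for a.e. $\xi\in G$; 8. $\sigma_V$ is $(G,A^*)$-locally nonzero at the origin: $\lim_{j\to\infty}\frac{|\{x\in G\cap A^{*-j}B_1:\ \sigma_V(x)=0\}|}{|G\cap A^{*-j}B_1|}=0$; 9. the origin is a point of $(G,A^*)$-approximate continuity of $\sigma_V$ if we put $\sigma_V(0)=1$: there is a measurable $E\subseteq\mathbb R^d$ of positive measure with $\lim_{j\to\infty}\frac{|E\cap G\cap A^{*-j}B_r|}{|G\cap A^{*-j}B_r|}=1$ for all $r>0$ and $\lim_{x\to0,\ x\in E}\sigma_V(x)=1$. -/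

import Mathlib

open MeasureTheory Filter Topology
open scoped FourierTransform ENNReal

noncomputable section

namespace ShiftInv

/-- `ℝ^d` with its Euclidean norm and Lebesgue measure. -/
abbrev Rd (d : ℕ) : Type := EuclideanSpace ℝ (Fin d)

/-- The complex Hilbert space `L²(ℝ^d)`. -/
abbrev L2 (d : ℕ) : Type := Lp ℂ 2 (volume : Measure (Rd d))

variable {d : ℕ}

/-- The point of the lattice `ℤ^d ⊆ ℝ^d` with coordinates `k`. -/
def intVec (k : Fin d → ℤ) : Rd d := WithLp.toLp 2 (fun i => (k i : ℝ))

/-- A linear map of `ℝ^d` is an expansive dilation if it maps `ℤ^d` into itself and all its complex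
eigenvalues (the complex roots of the characteristic polynomial) have modulus greater than `1`. -/
def IsExpansiveDilation (T : Rd d →L[ℝ] Rd d) : Prop :=
  (∀ k : Fin d → ℤ, ∃ m : Fin d → ℤ, T (intVec k) = intVec m) ∧
  ∀ z : ℂ, ((T : Rd d →ₗ[ℝ] Rd d).charpoly.map (algebraMap ℝ ℂ)).IsRoot z → 1 < ‖z‖

/-- Expansive dilations are invertible, so nothing is lost by working with units. -/
theorem IsExpansiveDilation.isUnit {T : Rd d →L[ℝ] Rd d} (hT : IsExpansiveDilation T) :
    IsUnit T := by
  have hker : LinearMap.ker (T : Rd d →ₗ[ℝ] Rd d) = ⊥ := by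
    by_contra hne
    have hev : Module.End.HasEigenvalue (T : Rd d →ₗ[ℝ] Rd d) 0 := by
      obtain ⟨v, hv, hv0⟩ := (Submodule.ne_bot_iff _).1 hne
      refine Module.End.hasEigenvalue_of_hasEigenvector (x := v)
        ⟨Module.End.mem_eigenspace_iff.2 ?_, hv0⟩
      rw [zero_smul]
      exact hv
    have hroot := (Module.End.hasEigenvalue_iff_isRoot_charpoly _ _).1 hev
    have := hT.2 0 (by simpa using hroot.map (f := algebraMap ℝ ℂ))
    norm_num at this
  let e : Rd d ≃L[ℝ] Rd d :=
    (LinearEquiv.ofInjectiveEndo (T : Rd d →ₗ[ℝ] Rd d)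
      (LinearMap.ker_eq_bot.1 hker)).toContinuousLinearEquiv
  refine ⟨ContinuousLinearEquiv.toUnit e, ?_⟩
  ext1 x
  rfl

/-- The translation operator `f ↦ f(· - t)` on `L²(ℝ^d)`. -/
def shift (t : Rd d) (f : L2 d) : L2 d :=
  Lp.compMeasurePreserving (fun x => x - t) (measurePreserving_sub_right volume t) f

/-- `d_A = |det A|`. -/
def absDet (A : (Rd d →L[ℝ] Rd d)ˣ) : ℝ := |(A : Rd d →L[ℝ] Rd d).det|

theorem det_ne_zero (A : (Rd d →L[ℝ] Rd d)ˣ) : (A : Rd d →L[ℝ] Rd d).det ≠ 0 := by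
  have h : LinearMap.det ((A : Rd d →L[ℝ] Rd d) : Rd d →ₗ[ℝ] Rd d) *
      LinearMap.det (((A⁻¹ : (Rd d →L[ℝ] Rd d)ˣ) : Rd d →L[ℝ] Rd d) : Rd d →ₗ[ℝ] Rd d) = 1 := by
    rw [← map_mul, ← LinearMap.det_id (A := ℝ) (M := Rd d)]
    congr 1
    ext1 x
    exact congrArg (fun T : Rd d →L[ℝ] Rd d => T x) A.mul_inv
  exact left_ne_zero_of_mul_eq_one h

theorem quasiMeasurePreserving (A : (Rd d →L[ℝ] Rd d)ˣ) :
    Measure.QuasiMeasurePreserving (A : Rd d →L[ℝ] Rd d) volume volume := by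
  refine ⟨(A : Rd d →L[ℝ] Rd d).continuous.measurable, ?_⟩
  have := Measure.map_linearMap_addHaar_eq_smul_addHaar (volume : Measure (Rd d))
    (f := ((A : Rd d →L[ℝ] Rd d) : Rd d →ₗ[ℝ] Rd d)) (det_ne_zero A)
  erw [this]
  exact Measure.smul_absolutelyContinuous

theorem memLp_dilate (A : (Rd d →L[ℝ] Rd d)ˣ) (f : L2 d) :
    MemLp (fun x => ((√(absDet A) : ℝ) : ℂ) * f ((A : Rd d →L[ℝ] Rd d) x)) 2 volume := by
  refine MemLp.const_mul ?_ _
  have hmap := Measure.map_linearMap_addHaar_eq_smul_addHaar (volume : Measure (Rd d))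
    (f := ((A : Rd d →L[ℝ] Rd d) : Rd d →ₗ[ℝ] Rd d)) (det_ne_zero A)
  have h1 : MemLp f 2 (Measure.map (A : Rd d →L[ℝ] Rd d) volume) := by
    erw [hmap]
    exact (Lp.memLp f).smul_measure ENNReal.ofReal_ne_top
  exact h1.comp_of_map (A : Rd d →L[ℝ] Rd d).continuous.aemeasurable

/-- `𝒟_A f(x) = d_A^{1/2} f(A x)`, as an element of `L²(ℝ^d)`. -/
def dilate (A : (Rd d →L[ℝ] Rd d)ˣ) (f : L2 d) : L2 d := (memLp_dilate A f).toLp _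

theorem coeFn_dilate (A : (Rd d →L[ℝ] Rd d)ˣ) (f : L2 d) :
    dilate A f =ᵐ[volume]
      fun x => ((√(absDet A) : ℝ) : ℂ) * f ((A : Rd d →L[ℝ] Rd d) x) :=
  MemLp.coeFn_toLp _

theorem dilate_inv (A B : (Rd d →L[ℝ] Rd d)ˣ) (hAB : A * B = 1) (f : L2 d) :
    dilate B (dilate A f) = f := by
  apply Lp.ext
  have h1 := coeFn_dilate B (dilate A f)
  have h2 := (quasiMeasurePreserving B).ae (coeFn_dilate A f)
  have hv : ∀ x, (A : Rd d →L[ℝ] Rd d) ((B : Rd d →L[ℝ] Rd d) x) = x := fun x =>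
    congrArg (fun T : (Rd d →L[ℝ] Rd d)ˣ => (T : Rd d →L[ℝ] Rd d) x) hAB
  have hdet : absDet B * absDet A = 1 := by
    rw [absDet, absDet, ← abs_mul, mul_comm]
    have : LinearMap.det ((A : Rd d →L[ℝ] Rd d) : Rd d →ₗ[ℝ] Rd d) *
        LinearMap.det ((B : Rd d →L[ℝ] Rd d) : Rd d →ₗ[ℝ] Rd d) = 1 := by
      rw [← map_mul, ← LinearMap.det_id (A := ℝ) (M := Rd d)]
      congr 1
      ext1 x
      exact hv x
    erw [this]
    simp
  have hs : ((√(absDet B) : ℝ) : ℂ) * ((√(absDet A) : ℝ) : ℂ) = 1 := by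
    rw [← Complex.ofReal_mul, ← Real.sqrt_mul (show 0 ≤ absDet B from abs_nonneg _), hdet]
    simp
  filter_upwards [h1, h2] with x hx1 hx2
  rw [hx1, hx2, hv, ← mul_assoc, hs, one_mul]

/-- The dilation operator `𝒟_A` on `L²(ℝ^d)`, an invertible linear map; its integer powers
`𝒟_A^j` are the powers in the group of linear automorphisms. -/
def dilation (A : (Rd d →L[ℝ] Rd d)ˣ) : L2 d ≃ₗ[ℂ] L2 d where
  toFun := dilate A
  invFun := dilate A⁻¹
  map_add' f g := by
    apply Lp.ext
    filter_upwards [coeFn_dilate A (f + g), coeFn_dilate A f, coeFn_dilate A g,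
      Lp.coeFn_add (dilate A f) (dilate A g),
      (quasiMeasurePreserving A).ae (Lp.coeFn_add f g)] with x h1 h2 h3 h4 h5
    rw [h1, h4, Pi.add_apply, h2, h3, h5, Pi.add_apply, mul_add]
  map_smul' c f := by
    apply Lp.ext
    filter_upwards [coeFn_dilate A (c • f), coeFn_dilate A f,
      Lp.coeFn_smul c (dilate A f),
      (quasiMeasurePreserving A).ae (Lp.coeFn_smul c f)] with x h1 h2 h3 h4
    rw [h1, RingHom.id_apply, h3, Pi.smul_apply, h2, h4, Pi.smul_apply, smul_eq_mul, smul_eq_mul]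
    ring
  left_inv := dilate_inv A A⁻¹ (mul_inv_cancel A)
  right_inv := dilate_inv A⁻¹ A (inv_mul_cancel A)

/-- `B^j x` for an integer `j`. -/
def powMap (B : (Rd d →L[ℝ] Rd d)ˣ) (j : ℤ) (x : Rd d) : Rd d :=
  ((B ^ j : (Rd d →L[ℝ] Rd d)ˣ) : Rd d →L[ℝ] Rd d) x

/-- Shift-invariant subspaces: closed subspaces of `L²(ℝ^d)` stable under translation by `ℤ^d`. -/
def IsShiftInvariant (V : Submodule ℂ (L2 d)) : Prop :=
  IsClosed (V : Set (L2 d)) ∧ ∀ f ∈ V, ∀ k : Fin d → ℤ, shift (intVec k) f ∈ V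

/-- `V` is `A`-refinable if `V ⊆ 𝒟_A V`. -/
def IsRefinable (A : (Rd d →L[ℝ] Rd d)ˣ) (V : Submodule ℂ (L2 d)) : Prop :=
  V ≤ V.map (dilation A).toLinearMap

/-- `{φ^α}_{α ∈ ι} ⊆ V` is a tight frame generator of `V`: for `f ∈ V`, the sum over `α` and
`k ∈ ℤ^d` of `|⟨f, φ^α(· - k)⟩|²` is `‖f‖²`. -/
def IsTightFrameGenerator {ι : Type*} (V : Submodule ℂ (L2 d)) (φ : ι → L2 d) : Prop :=
  (∀ α, φ α ∈ V) ∧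
  ∀ f ∈ V, HasSum
    (fun p : ι × (Fin d → ℤ) => ‖inner ℂ f (shift (intVec p.2) (φ p.1))‖ ^ 2) (‖f‖ ^ 2)

/-- `σ` is (a representative of) the spectral function of `V`: almost everywhere
`σ(ξ) = ∑_α |φ̂^α(ξ)|²` for some tight frame generator of `V`. -/
def IsSpectralFunction (V : Submodule ℂ (L2 d)) (σ : Rd d → ℝ) : Prop :=
  ∃ (ι : Type) (φ : ι → L2 d), IsTightFrameGenerator V φ ∧
    σ =ᵐ[volume] fun ξ => ∑' α, ‖(𝓕 (φ α) : L2 d) ξ‖ ^ 2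

/-- `𝒮` generates `V`: it lies in `V` and the linear span of its integer shifts is dense in `V`. -/
def Generates (𝒮 : Set (L2 d)) (V : Submodule ℂ (L2 d)) : Prop :=
  𝒮 ⊆ V ∧
  (V : Set (L2 d)) ⊆ closure (Submodule.span ℂ
    {g : L2 d | ∃ φ ∈ 𝒮, ∃ k : Fin d → ℤ, g = shift (intVec k) φ} : Set (L2 d))

/-- `H²_G`, the functions in `L²(ℝ^d)` whose Fourier transform vanishes a.e. outside `G`. -/
def hardySpace (G : Set (Rd d)) : Set (L2 d) :=
  {f | ∀ᵐ ξ ∂(volume : Measure (Rd d)), ξ ∉ G → (𝓕 f : L2 d) ξ = 0}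

/-- `⋃ᵢ Sᵢ = G` up to null sets. For an uncountable family of sets that are only determined up to
null sets the union is the essential one, i.e. the least set, modulo null sets, that contains every
`Sᵢ` modulo null sets; see `isUnionModNull_iff` for countable families. -/
def IsUnionModNull {ι : Type*} (S : ι → Set (Rd d)) (G : Set (Rd d)) : Prop :=
  (∀ i, S i ≤ᵐ[volume] G) ∧
  ∀ H : Set (Rd d), MeasurableSet H → (∀ i, S i ≤ᵐ[volume] H) → G ≤ᵐ[volume] H

theorem isUnionModNull_iff {ι : Type*} [Countable ι] (S : ι → Set (Rd d)) (G : Set (Rd d))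
    (hS : ∀ i, MeasurableSet (S i)) : IsUnionModNull S G ↔ (⋃ i, S i) =ᵐ[volume] G := by
  constructor
  · rintro ⟨h1, h2⟩
    refine Filter.EventuallyLE.antisymm ?_
      (h2 _ (MeasurableSet.iUnion hS) fun i => (Set.subset_iUnion S i).eventuallyLE)
    filter_upwards [ae_all_iff.2 h1] with x hx hxU
    obtain ⟨i, hi⟩ := Set.mem_iUnion.1 hxU
    exact hx i hi
  · intro h
    refine ⟨fun i => (Set.subset_iUnion S i).eventuallyLE.trans h.le, fun H _ hH => ?_⟩
    refine h.symm.le.trans ?_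
    filter_upwards [ae_all_iff.2 hH] with x hx hxU
    obtain ⟨i, hi⟩ := Set.mem_iUnion.1 hxU
    exact hx i hi

/-- The union over `φ ∈ 𝒮` and `j ∈ ℤ` of `A^{*j}(Supp φ̂)` is `G`, up to null sets. -/
def SupportsCover (A : (Rd d →L[ℝ] Rd d)ˣ) (𝒮 : Set (L2 d)) (G : Set (Rd d)) : Prop :=
  IsUnionModNull
    (fun p : 𝒮 × ℤ => powMap (star A) p.2 '' Function.support ((𝓕 (p.1 : L2 d) : L2 d) : Rd d → ℂ))
    G

/-- `E` is `B`-absorbing in `G`. -/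
def IsAbsorbing (B : (Rd d →L[ℝ] Rd d)ˣ) (E G : Set (Rd d)) : Prop :=
  ∀ᵐ ξ ∂(volume : Measure (Rd d)), ξ ∈ G → ∃ j₀ : ℕ, 0 < j₀ ∧ ∀ j : ℕ, j₀ ≤ j → powMap B j ξ ∈ E

/-- `B^{-j} B_r`, where `B_r` is the open ball of radius `r` around the origin. -/
def shrunkBall (B : (Rd d →L[ℝ] Rd d)ˣ) (j : ℕ) (r : ℝ) : Set (Rd d) :=
  powMap B (-(j : ℤ)) '' Metric.ball 0 r

/-- The origin is a point of `(G, B)`-density for `E`. -/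
def IsDensityPoint (G : Set (Rd d)) (B : (Rd d →L[ℝ] Rd d)ˣ) (E : Set (Rd d)) : Prop :=
  ∀ r : ℝ, 0 < r → Tendsto
    (fun j : ℕ => volume.real (E ∩ G ∩ shrunkBall B j r) / volume.real (G ∩ shrunkBall B j r))
    atTop (𝓝 1)

/-- The origin is a point of `(G, B)`-approximate continuity of `f`. -/
def IsApproxContinuous (G : Set (Rd d)) (B : (Rd d →L[ℝ] Rd d)ˣ) (f : Rd d → ℝ) : Prop :=
  ∃ E : Set (Rd d), MeasurableSet E ∧ 0 < volume E ∧ IsDensityPoint G B E ∧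
    Tendsto f (𝓝[E] 0) (𝓝 (f 0))

/-- `f` is `(G, B)`-locally nonzero at the origin. -/
def IsLocallyNonzero (G : Set (Rd d)) (B : (Rd d →L[ℝ] Rd d)ˣ) (f : Rd d → ℝ) : Prop :=
  Tendsto
    (fun j : ℕ => volume.real {x | x ∈ G ∩ shrunkBall B j 1 ∧ f x = 0} /
      volume.real (G ∩ shrunkBall B j 1))
    atTop (𝓝 0)

end ShiftInv

end

noncomputable section

namespace ShiftInv

variable {d : ℕ}

open scoped SchwartzMap

/-! ### Linear changes of variables -/

/-! On the Fourier side integer shifts become multiplications by characters, and `𝒟_A` becomes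
dilation by the inverse adjoint. Let `f_E` have Fourier transform `1_E`. If `E` lies in a unit cube,
the numbers `⟨f_E, φ(· - k)⟩` are the Fourier coefficients of `1_E φ̂`. Parseval and the tight frame
identity then give, with `P` the orthogonal projection onto `V`, the central formula `∫_E σ = ‖P
f_E‖²` for `E` in a ball of radius `1/2` (`IsTightFrameGenerator.lintegral_eq`). Since `P` is a
contraction, `0 ≤ σ ≤ 1` a.e. Refinability gives `‖P f‖ ≤ ‖P 𝒟_A⁻¹ f‖`, hence `σ(ξ) ≤ σ(A*⁻¹ξ)` a.e.
(`IsSpectralData.le_comp`). So `σ` increases along almost every orbit `A*⁻ʲξ`. These orbits tend to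
`0` and `G` is invariant, so the relevant a.e. statements on `G` need only be checked on `G ∩ B_1`.
Rescaling turns densities at the origin into statements about `σ(A*⁻ʲ·)` on a fixed bounded set,
where dominated convergence applies. That the limit along orbits is exactly `1` comes from
completeness. If `g` is orthogonal to all dilates of `V`, then `⟨g, f(· - t)⟩` vanishes for `f` in a
dilate of `V` and `t` in all sufficiently fine lattices `A⁻ʲℤ^d`. These become dense, so `conj ĝ ·
f̂` has zero Fourier transform and vanishes a.e.; thus `ĝ = 0` on all dilated supports, and a cover
of `G` by these supports forces completeness (`closure_eq_of_supportsCover`). Conversely, under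
completeness the average of `σ` over `A*⁻ʲE` equals `‖P 𝒟_A⁻ʲ f_E‖² / |E|` for large `j`, which
tends to `1` (`IsSpectralData.tendsto_average`); a monotone limit bounded by `1` with average `1` is
`1`. -/

theorem unit_apply_inv (A : (Rd d →L[ℝ] Rd d)ˣ) (x : Rd d) : A.val ((A⁻¹).val x) = x :=
  congrArg (fun T : Rd d →L[ℝ] Rd d => T x) A.mul_inv

theorem unit_inv_apply (A : (Rd d →L[ℝ] Rd d)ˣ) (x : Rd d) : (A⁻¹).val (A.val x) = x :=
  congrArg (fun T : Rd d →L[ℝ] Rd d => T x) A.inv_mul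

theorem absDet_pos (A : (Rd d →L[ℝ] Rd d)ˣ) : 0 < absDet A := abs_pos.2 (det_ne_zero A)

theorem absDet_mul (A B : (Rd d →L[ℝ] Rd d)ˣ) : absDet (A * B) = absDet A * absDet B := by
  rw [absDet, absDet, absDet, ← abs_mul]
  congr 1
  exact map_mul LinearMap.det (A.val : Rd d →ₗ[ℝ] Rd d) (B.val : Rd d →ₗ[ℝ] Rd d)

theorem absDet_one : absDet (1 : (Rd d →L[ℝ] Rd d)ˣ) = 1 := by
  have h := absDet_mul (1 : (Rd d →L[ℝ] Rd d)ˣ) 1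
  rw [one_mul] at h
  nlinarith [absDet_pos (1 : (Rd d →L[ℝ] Rd d)ˣ)]

theorem absDet_inv (A : (Rd d →L[ℝ] Rd d)ˣ) : absDet A⁻¹ = (absDet A)⁻¹ := by
  have h := absDet_mul A A⁻¹
  rw [mul_inv_cancel, absDet_one] at h
  exact eq_inv_of_mul_eq_one_right h.symm

theorem absDet_star (A : (Rd d →L[ℝ] Rd d)ˣ) : absDet (star A) = absDet A := by
  have h : LinearMap.det ((star A).val : Rd d →ₗ[ℝ] Rd d) =
      LinearMap.det (A.val : Rd d →ₗ[ℝ] Rd d) := by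
    have hb := EuclideanSpace.basisFun (Fin d) ℝ
    rw [← LinearMap.det_toMatrix hb.toBasis, ← LinearMap.det_toMatrix hb.toBasis (A.val : _ →ₗ[ℝ] _)]
    have : ((star A).val : Rd d →ₗ[ℝ] Rd d) = LinearMap.adjoint (A.val : Rd d →ₗ[ℝ] Rd d) := by
      rw [Units.coe_star, ContinuousLinearMap.star_eq_adjoint]
      rfl
    rw [this, LinearMap.toMatrix_adjoint, Matrix.det_conjTranspose]
    simp
  exact congrArg abs h

theorem measurableEmbedding_unit (A : (Rd d →L[ℝ] Rd d)ˣ) : MeasurableEmbedding (A.val) :=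
  (ContinuousLinearEquiv.ofUnit A).toHomeomorph.measurableEmbedding

theorem map_unit_volume (A : (Rd d →L[ℝ] Rd d)ˣ) :
    Measure.map A.val volume = ENNReal.ofReal (absDet A)⁻¹ • (volume : Measure (Rd d)) := by
  have := Measure.map_linearMap_addHaar_eq_smul_addHaar (volume : Measure (Rd d))
    (f := (A.val : Rd d →ₗ[ℝ] Rd d)) (det_ne_zero A)
  rw [abs_inv] at this
  exact this

theorem lintegral_comp_unit (A : (Rd d →L[ℝ] Rd d)ˣ) (g : Rd d → ℝ≥0∞) :
    ∫⁻ x, g (A.val x) = ENNReal.ofReal (absDet A)⁻¹ * ∫⁻ x, g x := by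
  rw [← (measurableEmbedding_unit A).lintegral_map, map_unit_volume, lintegral_smul_measure,
    smul_eq_mul]

theorem integral_comp_unit {F : Type*} [NormedAddCommGroup F] [NormedSpace ℝ F]
    (A : (Rd d →L[ℝ] Rd d)ˣ) (g : Rd d → F) :
    ∫ x, g (A.val x) = (absDet A)⁻¹ • ∫ x, g x := by
  rw [← (measurableEmbedding_unit A).integral_map, map_unit_volume, integral_smul_measure,
    ENNReal.toReal_ofReal (inv_nonneg.2 (absDet_pos A).le)]

/-! ### Translations, modulations and dilations on `L²` -/

theorem norm_sq_eq_integral (f : L2 d) : ‖f‖ ^ 2 = ∫ x, ‖f x‖ ^ 2 := by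
  have h := @inner_self_eq_norm_sq ℂ _ _ _ _ f
  rw [← h, L2.inner_def, ← integral_re (L2.integrable_inner f f)]
  refine integral_congr_ae (Eventually.of_forall fun x => ?_)
  exact inner_self_eq_norm_sq (𝕜 := ℂ) (f x)

theorem norm_dilate (A : (Rd d →L[ℝ] Rd d)ˣ) (f : L2 d) : ‖dilate A f‖ = ‖f‖ := by
  have h : ‖dilate A f‖ ^ 2 = ‖f‖ ^ 2 := by
    rw [norm_sq_eq_integral, norm_sq_eq_integral]
    have h1 : ∫ x, ‖dilate A f x‖ ^ 2 = ∫ x, absDet A * ‖f (A.val x)‖ ^ 2 := by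
      refine integral_congr_ae ?_
      filter_upwards [coeFn_dilate A f] with x hx
      rw [hx, norm_mul, mul_pow, Complex.norm_real, Real.norm_eq_abs, sq_abs,
        Real.sq_sqrt (absDet_pos A).le]
    rw [h1, integral_const_mul, integral_comp_unit A (fun x => ‖f x‖ ^ 2), smul_eq_mul,
      ← mul_assoc, mul_inv_cancel₀ (absDet_pos A).ne', one_mul]
  exact (sq_eq_sq₀ (norm_nonneg _) (norm_nonneg _)).1 h

/-- The dilation operator as a unitary operator. -/
def dilationₗᵢ (A : (Rd d →L[ℝ] Rd d)ˣ) : L2 d ≃ₗᵢ[ℂ] L2 d where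
  toLinearEquiv := dilation A
  norm_map' := norm_dilate A

theorem coeFn_shift (t : Rd d) (f : L2 d) : shift t f =ᵐ[volume] fun x => f (x - t) :=
  Lp.coeFn_compMeasurePreserving f (measurePreserving_sub_right volume t)

theorem isometry_shift (t : Rd d) : Isometry (shift t : L2 d → L2 d) :=
  Lp.isometry_compMeasurePreserving (measurePreserving_sub_right volume t)

/-- The character `ξ ↦ e^{-2π i t·ξ}`. -/
def character (t ξ : Rd d) : ℂ := (Real.fourierChar (-inner ℝ t ξ) : ℂ)

theorem norm_character (t ξ : Rd d) : ‖character t ξ‖ = 1 := Circle.norm_coe _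

theorem continuous_character (t : Rd d) : Continuous (character t) := by
  unfold character
  fun_prop

theorem memLp_modulate (t : Rd d) (f : L2 d) : MemLp (fun ξ => character t ξ * f ξ) 2 volume :=
  (Lp.memLp f).of_le ((continuous_character t).aestronglyMeasurable.mul
    (Lp.aestronglyMeasurable f)) (Eventually.of_forall fun x => by
      rw [norm_mul, norm_character, one_mul])

/-- Multiplication by a character. -/
def modulate (t : Rd d) (f : L2 d) : L2 d := (memLp_modulate t f).toLp _

theorem coeFn_modulate (t : Rd d) (f : L2 d) :
    modulate t f =ᵐ[volume] fun ξ => character t ξ * f ξ := MemLp.coeFn_toLp _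

theorem isometry_modulate (t : Rd d) : Isometry (modulate t : L2 d → L2 d) := by
  refine Isometry.of_dist_eq fun f g => ?_
  rw [dist_eq_norm, dist_eq_norm, Lp.norm_def, Lp.norm_def]
  congr 1
  refine eLpNorm_congr_norm_ae ?_
  filter_upwards [Lp.coeFn_sub (modulate t f) (modulate t g), Lp.coeFn_sub f g,
    coeFn_modulate t f, coeFn_modulate t g] with x h1 h2 h3 h4
  rw [h1, h2, Pi.sub_apply, Pi.sub_apply, h3, h4, ← mul_sub, norm_mul, norm_character, one_mul]

/-- Both sides are isometric in `f`, so it suffices to check the classical formula on the dense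
class of Schwartz functions. -/
theorem fourier_shift (t : Rd d) (f : L2 d) : (𝓕 (shift t f) : L2 d) = modulate t (𝓕 f) := by
  refine DenseRange.induction_on (p := fun f : L2 d => (𝓕 (shift t f) : L2 d) = modulate t (𝓕 f))
    (SchwartzMap.denseRange_toLpCLM (p := 2) ENNReal.ofNat_ne_top) f ?_ ?_
  · exact isClosed_eq ((Lp.fourierTransformₗᵢ (Rd d) ℂ).continuous.comp
      (isometry_shift t).continuous)
      ((isometry_modulate t).continuous.comp (Lp.fourierTransformₗᵢ (Rd d) ℂ).continuous)
  · intro g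
    rw [SchwartzMap.toLpCLM_apply]
    have hg0 : ∀ᵐ x, (g.toLp 2 : L2 d) x = g x := g.coeFn_toLp 2 volume
    have hg1 : ∀ᵐ x, ((𝓕 g).toLp 2 : L2 d) x = 𝓕 g x := (𝓕 g).coeFn_toLp 2 volume
    have h1 : shift t (g.toLp 2) = (SchwartzMap.compSubConstCLM ℂ t g).toLp 2 := by
      apply Lp.ext
      filter_upwards [coeFn_shift t (g.toLp 2),
        (measurePreserving_sub_right volume t).quasiMeasurePreserving.ae hg0,
        (SchwartzMap.compSubConstCLM ℂ t g).coeFn_toLp 2] with x a b c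
      rw [a, b, c]
      rfl
    rw [h1, SchwartzMap.toLp_fourier_eq, SchwartzMap.toLp_fourier_eq]
    apply Lp.ext
    filter_upwards [(𝓕 (SchwartzMap.compSubConstCLM ℂ t g)).coeFn_toLp 2, hg1,
      coeFn_modulate t ((𝓕 g).toLp 2)] with x a b c
    rw [a, c, b, SchwartzMap.fourier_coe, SchwartzMap.fourier_coe]
    have := congrFun (VectorFourier.fourierIntegral_comp_add_right Real.fourierChar
      (volume : Measure (Rd d)) (innerₗ (Rd d)) (g : Rd d → ℂ) (-t)) x
    rw [map_neg, LinearMap.neg_apply, innerₗ_apply_apply] at this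
    refine Eq.trans ?_ this
    rfl

theorem coeFn_fourier_shift (t : Rd d) (f : L2 d) :
    (𝓕 (shift t f) : L2 d) =ᵐ[volume] fun ξ => character t ξ * (𝓕 f : L2 d) ξ := by
  rw [fourier_shift]
  exact coeFn_modulate t _

theorem inner_inv_star (A : (Rd d →L[ℝ] Rd d)ˣ) (x ξ : Rd d) :
    inner ℝ x (((star A)⁻¹).val (ξ)) = inner ℝ ((A⁻¹).val x) ξ := by
  have : (star A)⁻¹ = star A⁻¹ := (star_inv A).symm
  rw [this, Units.coe_star, ContinuousLinearMap.star_eq_adjoint,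
    ContinuousLinearMap.adjoint_inner_right]

theorem fourier_dilate (A : (Rd d →L[ℝ] Rd d)ˣ) (f : L2 d) :
    (𝓕 (dilate A f) : L2 d) = dilate (star A)⁻¹ (𝓕 f) := by
  refine DenseRange.induction_on
    (p := fun f : L2 d => (𝓕 (dilate A f) : L2 d) = dilate (star A)⁻¹ (𝓕 f))
    (SchwartzMap.denseRange_toLpCLM (p := 2) ENNReal.ofNat_ne_top) f ?_ ?_
  · exact isClosed_eq ((Lp.fourierTransformₗᵢ (Rd d) ℂ).continuous.comp
      (dilationₗᵢ A).continuous)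
      ((dilationₗᵢ (star A)⁻¹).continuous.comp (Lp.fourierTransformₗᵢ (Rd d) ℂ).continuous)
  · intro g
    rw [SchwartzMap.toLpCLM_apply]
    have hg0 : ∀ᵐ x, (g.toLp 2 : L2 d) x = g x := g.coeFn_toLp 2 volume
    have hg1 : ∀ᵐ x, ((𝓕 g).toLp 2 : L2 d) x = 𝓕 g x := (𝓕 g).coeFn_toLp 2 volume
    set gA : 𝓢(Rd d, ℂ) := ((√(absDet A) : ℝ) : ℂ) • SchwartzMap.compCLMOfContinuousLinearEquiv ℂ
      (ContinuousLinearEquiv.ofUnit A) g with hgA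
    have hgA' : ∀ x, gA x = ((√(absDet A) : ℝ) : ℂ) * g (A.val x) := fun x => rfl
    have h1 : dilate A (g.toLp 2) = gA.toLp 2 := by
      apply Lp.ext
      filter_upwards [coeFn_dilate A (g.toLp 2),
        (quasiMeasurePreserving A).ae hg0, gA.coeFn_toLp 2] with x a b c
      rw [a, b, c, hgA']
    rw [h1, SchwartzMap.toLp_fourier_eq, SchwartzMap.toLp_fourier_eq]
    apply Lp.ext
    filter_upwards [(𝓕 gA).coeFn_toLp 2,
      (quasiMeasurePreserving (star A)⁻¹).ae hg1,
      coeFn_dilate (star A)⁻¹ ((𝓕 g).toLp 2)] with ξ a b c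
    rw [a, c, b, SchwartzMap.fourier_coe, SchwartzMap.fourier_coe, Real.fourier_eq,
      Real.fourier_eq]
    have h2 : ∀ v : Rd d, Real.fourierChar (-inner ℝ v ξ) • gA v = (fun y =>
        ((√(absDet A) : ℝ) : ℂ) * (Real.fourierChar (-inner ℝ y (((star A)⁻¹).val ξ)) • g y))
        (A.val v) := by
      intro v
      simp only [hgA', inner_inv_star, unit_inv_apply, Circle.smul_def, smul_eq_mul]
      ring
    simp_rw [h2]
    rw [integral_comp_unit A (fun y => ((√(absDet A) : ℝ) : ℂ) *
      (Real.fourierChar (-inner ℝ y (((star A)⁻¹).val ξ)) • g y)), integral_const_mul,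
      absDet_inv, absDet_star, ← Complex.coe_smul, smul_eq_mul, ← mul_assoc]
    congr 1
    rw [← Complex.ofReal_mul]
    congr 1
    -- The Jacobian `|det A|⁻¹` times the normalising factor `√|det A|` is the normalising factor of
    -- the inverse adjoint.
    have hs := Real.mul_self_sqrt (absDet_pos A).le
    have hs0 := (Real.sqrt_pos.2 (absDet_pos A)).ne'
    rw [Real.sqrt_inv]
    nth_rewrite 1 [← hs]
    field_simp

/-! ### Injectivity of the Fourier transform on `L¹` -/

/-- A test function `g` is the Fourier transform of a Schwartz function; moving the transform over
to `F` shows `∫ g F = 0`. -/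
theorem ae_eq_zero_of_fourier_eq_zero {F : Rd d → ℂ} (hF : Integrable F)
    (h : ∀ t, 𝓕 F t = 0) : ∀ᵐ ξ, F ξ = 0 := by
  refine ae_eq_zero_of_integral_contDiff_smul_eq_zero hF.locallyIntegrable fun g hg hgc => ?_
  have hgc' : HasCompactSupport (fun x => (g x : ℂ)) := hgc.comp_left (g := fun r : ℝ => (r : ℂ)) rfl
  have hg' : ContDiff ℝ (⊤ : ℕ∞) (fun x => (g x : ℂ)) := Complex.ofRealCLM.contDiff.comp hg
  set G : 𝓢(Rd d, ℂ) := hgc'.toSchwartzMap hg' with hG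
  have hGx : ∀ x, G x = (g x : ℂ) := fun x => rfl
  have key := VectorFourier.integral_fourierIntegral_smul_eq_flip (e := Real.fourierChar)
    (L := innerₗ (Rd d)) (μ := volume) (ν := volume) Real.continuous_fourierChar
    (by simpa using! continuous_inner) hF (𝓕⁻ G).integrable
  have h1 : ∀ ξ, VectorFourier.fourierIntegral Real.fourierChar volume (innerₗ (Rd d)) F ξ = 0 := h
  have h2 : ∀ x, VectorFourier.fourierIntegral Real.fourierChar volume (innerₗ (Rd d)).flip
      ((𝓕⁻ G : 𝓢(Rd d, ℂ)) : Rd d → ℂ) x = (g x : ℂ) := by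
    intro x
    rw [flip_innerₗ, ← hGx]
    have : 𝓕 (𝓕⁻ G) = G := FourierTransform.fourier_fourierInv_eq G
    conv_rhs => rw [← this]
    rfl
  simp only [h1, h2, zero_smul, integral_zero] at key
  rw [key]
  refine integral_congr_ae (Eventually.of_forall fun x => ?_)
  simp [mul_comm]

end ShiftInv

end

noncomputable section

namespace ShiftInv

variable {d : ℕ}

/-! ### Parseval's identity on a unit cube, transported from the torus -/

section Parseval

local instance : MeasureSpace UnitAddCircle := ⟨AddCircle.haarAddCircle⟩

/-- The section of the covering `ℝ^d → ℝ^d/ℤ^d` with values in the unit cube with corner `a`. -/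
def torusSection (a : Fin d → ℝ) (x : UnitAddTorus (Fin d)) : Rd d :=
  WithLp.toLp 2 (UnitAddTorus.measurableEquivPiIoc a x).1

/-- The half-open unit cube with corner `a`. -/
def unitCube (a : Fin d → ℝ) : Set (Rd d) := {x | ∀ i, x i ∈ Set.Ioc (a i) (a i + 1)}

theorem measurableSet_unitCube (a : Fin d → ℝ) : MeasurableSet (unitCube a) := by
  have : unitCube a = ⋂ i, (fun x : Rd d => x i) ⁻¹' Set.Ioc (a i) (a i + 1) := by
    ext x
    simp [unitCube]
  rw [this]
  exact MeasurableSet.iInter fun i => measurableSet_Ioc.preimage (by fun_prop)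

theorem measurePreserving_torusSection (a : Fin d → ℝ) :
    MeasurePreserving (torusSection a) volume (volume.restrict (unitCube a)) := by
  have h1 := UnitAddTorus.measurePreserving_equivPiIoc a
  have hs : MeasurableSet {x : Fin d → ℝ | ∀ i, x i ∈ Set.Ioc (a i) (a i + 1)} :=
    MeasurableSet.univ_pi' fun i => measurableSet_Ioc
  have h2 : MeasurePreserving (Subtype.val :
      {x : Fin d → ℝ // ∀ i, x i ∈ Set.Ioc (a i) (a i + 1)} → _)
      (Measure.comap Subtype.val volume)
      (volume.restrict {x : Fin d → ℝ | ∀ i, x i ∈ Set.Ioc (a i) (a i + 1)}) :=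
    measurePreserving_subtype_coe hs
  have h3 := (PiLp.volume_preserving_toLp (Fin d)).restrict_preimage (measurableSet_unitCube a)
  exact (h3.comp h2).comp h1

/-- The minus sign matches the convention `e^{-2π i t·ξ}` of `character`; the choice of the cube is
immaterial for integer frequencies. -/
theorem mFourier_neg_eq_character (a : Fin d → ℝ) (k : Fin d → ℤ) (x : UnitAddTorus (Fin d)) :
    UnitAddTorus.mFourier (-k) x = character (intVec k) (torusSection a x) := by
  obtain ⟨y, rfl⟩ := (UnitAddTorus.measurableEquivPiIoc a).symm.surjective x
  rw [torusSection, MeasurableEquiv.apply_symm_apply,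
    UnitAddTorus.coe_symm_measurableEquivPiIoc_apply]
  rw [character, Real.fourierChar_apply]
  simp only [UnitAddTorus.mFourier, ContinuousMap.coe_mk, fourier_coe_apply]
  rw [← Complex.exp_sum]
  congr 1
  simp only [intVec, PiLp.inner_apply, Pi.neg_apply]
  push_cast
  simp only [RCLike.inner_apply, conj_trivial, Complex.ofReal_mul, Complex.ofReal_intCast]
  rw [mul_neg, neg_mul, Finset.mul_sum, Finset.sum_mul, ← Finset.sum_neg_distrib]
  refine Finset.sum_congr rfl fun i _ => ?_
  ring

/-- Parseval's identity for functions supported in a unit cube. -/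
theorem hasSum_sq_integral_character (a : Fin d → ℝ) {h : Rd d → ℂ} (hh : MemLp h 2 volume)
    (hs : ∀ ξ, ξ ∉ unitCube a → h ξ = 0) :
    HasSum (fun k : Fin d → ℤ => ‖∫ ξ, character (intVec k) ξ * h ξ‖ ^ 2) (∫ ξ, ‖h ξ‖ ^ 2) := by
  have hmp := measurePreserving_torusSection a
  have hH : MemLp (h ∘ torusSection a) 2 volume := (hh.restrict _).comp_measurePreserving hmp
  have hint : ∀ {F : Type} [NormedAddCommGroup F] [NormedSpace ℝ F] (g : Rd d → F),
      AEStronglyMeasurable g volume → (∀ ξ, ξ ∉ unitCube a → g ξ = 0) →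
      ∫ x, g (torusSection a x) = ∫ ξ, g ξ := by
    intro F _ _ g hg hg0
    rw [← setIntegral_eq_integral_of_forall_compl_eq_zero hg0, ← hmp.map_eq, integral_map
      hmp.measurable.aemeasurable]
    rw [hmp.map_eq]
    exact hg.restrict
  have key := UnitAddTorus.hasSum_sq_mFourierCoeff (hH.toLp _)
  have e1 : ∫ t, ‖hH.toLp _ t‖ ^ 2 = ∫ ξ, ‖h ξ‖ ^ 2 := by
    rw [← hint (fun ξ => ‖h ξ‖ ^ 2) (hh.1.norm.pow 2) fun ξ hξ => by simp [hs ξ hξ]]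
    refine integral_congr_ae ?_
    filter_upwards [hH.coeFn_toLp] with x hx
    rw [hx, Function.comp]
  have e2 : ∀ k, UnitAddTorus.mFourierCoeff (hH.toLp _) k =
      ∫ ξ, character (intVec k) ξ * h ξ := by
    intro k
    rw [← hint (fun ξ => character (intVec k) ξ * h ξ)
      ((continuous_character _).aestronglyMeasurable.mul hh.1) fun ξ hξ => by simp [hs ξ hξ]]
    refine integral_congr_ae ?_
    filter_upwards [hH.coeFn_toLp] with x hx
    rw [hx, mFourier_neg_eq_character a, Function.comp, smul_eq_mul]
  rw [e1] at key
  simp_rw [e2] at key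
  exact key

end Parseval

/-- Source of the radius `1/2` below: it guarantees that Parseval on one unit cube applies. -/
theorem ball_subset_unitCube (c : Rd d) :
    Metric.ball c (1 / 2) ⊆ unitCube fun i => c i - 1 / 2 := by
  intro x hx i
  have h1 : ‖(x - c) i‖ ≤ ‖x - c‖ := PiLp.norm_apply_le _ _
  rw [Metric.mem_ball, dist_eq_norm] at hx
  have h2 : |x i - c i| < 1 / 2 := by
    refine lt_of_le_of_lt ?_ hx
    simpa using h1
  rw [abs_lt] at h2
  constructor <;> simp only <;> linarith

/-! ### The functions whose Fourier transform is an indicator function -/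

/-- The function in `L²` with Fourier transform `1_E`. -/
def fourierIndicator (E : Set (Rd d)) (hE : MeasurableSet E) (hE' : volume E ≠ ⊤) : L2 d :=
  𝓕⁻ (indicatorConstLp 2 hE hE' (1 : ℂ))

theorem fourier_fourierIndicator (E : Set (Rd d)) (hE : MeasurableSet E) (hE' : volume E ≠ ⊤) :
    (𝓕 (fourierIndicator E hE hE') : L2 d) = indicatorConstLp 2 hE hE' (1 : ℂ) :=
  FourierTransform.fourier_fourierInv_eq _

theorem norm_sq_fourierIndicator (E : Set (Rd d)) (hE : MeasurableSet E) (hE' : volume E ≠ ⊤) :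
    ‖fourierIndicator E hE hE'‖ ^ 2 = volume.real E := by
  rw [← Lp.norm_fourier_eq, fourier_fourierIndicator, norm_indicatorConstLp (by simp) (by simp)]
  rw [norm_one, one_mul, ← Real.rpow_natCast, ← Real.rpow_mul measureReal_nonneg]
  norm_num

theorem inner_shift_eq_integral (t : Rd d) (f g : L2 d) :
    inner ℂ f (shift t g) =
      ∫ ξ, character t ξ * (starRingEnd ℂ ((𝓕 f : L2 d) ξ) * (𝓕 g : L2 d) ξ) := by
  rw [← Lp.inner_fourier_eq, L2.inner_def]
  refine integral_congr_ae ?_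
  filter_upwards [coeFn_fourier_shift t g] with ξ hξ
  rw [hξ, RCLike.inner_apply]
  ring

/-- By Plancherel the inner products are the Fourier coefficients of `1_E φ̂`, a function living on
a single unit cube. -/
theorem hasSum_inner_fourierIndicator {E : Set (Rd d)} (hE : MeasurableSet E)
    (hE' : volume E ≠ ⊤) {c : Rd d} (hc : E ⊆ Metric.ball c (1 / 2)) (φ : L2 d) :
    HasSum (fun k : Fin d → ℤ =>
      ‖inner ℂ (fourierIndicator E hE hE') (shift (intVec k) φ)‖ ^ 2)
      (∫ ξ in E, ‖(𝓕 φ : L2 d) ξ‖ ^ 2) := by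
  have h := hasSum_sq_integral_character (fun i => c i - 1 / 2)
    (h := E.indicator ((𝓕 φ : L2 d) : Rd d → ℂ)) ((Lp.memLp _).indicator hE)
    (fun ξ hξ => Set.indicator_of_notMem (fun h => hξ (ball_subset_unitCube c (hc h))) _)
  have e1 : ∫ ξ, ‖E.indicator ((𝓕 φ : L2 d) : Rd d → ℂ) ξ‖ ^ 2 =
      ∫ ξ in E, ‖(𝓕 φ : L2 d) ξ‖ ^ 2 := by
    rw [← integral_indicator hE]
    refine integral_congr_ae (Eventually.of_forall fun ξ => ?_)
    by_cases hξ : ξ ∈ E <;> simp [hξ]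
  rw [e1] at h
  refine h.congr_fun fun k => ?_
  congr 2
  rw [inner_shift_eq_integral]
  refine integral_congr_ae ?_
  rw [fourier_fourierIndicator]
  filter_upwards [indicatorConstLp_coeFn (p := 2) (hs := hE) (hμs := hE') (c := (1 : ℂ))] with ξ hξ
  rw [hξ]
  by_cases hξ' : ξ ∈ E <;> simp [hξ']

end ShiftInv

end

noncomputable section

namespace ShiftInv

variable {d : ℕ}

/-! ### Expansive dilations -/

section Gelfand

attribute [local instance] Matrix.linftyOpNormedRing Matrix.linftyOpNormedAlgebra

/-- Gelfand's formula: the spectral radius is below `1`, so `‖N ^ j‖` is eventually at most `r ^ j`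
for some `r < 1`. -/
theorem tendsto_matrix_pow_zero {n : ℕ} (N : Matrix (Fin n) (Fin n) ℂ)
    (hN : ∀ z ∈ spectrum ℂ N, ‖z‖ < 1) : Tendsto (fun j : ℕ => N ^ j) atTop (𝓝 0) := by
  rcases isEmpty_or_nonempty (Fin n) with h | h
  · have : ∀ j : ℕ, N ^ j = 0 := fun j => Subsingleton.elim _ _
    simp only [this]
    exact tendsto_const_nhds
  have hr : spectralRadius ℂ N < (1 : NNReal) :=
    spectrum.spectralRadius_lt_of_forall_lt N fun z hz => by exact_mod_cast hN z hz
  obtain ⟨r, hr1, hr2⟩ := ENNReal.lt_iff_exists_nnreal_btwn.1 hr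
  have hlim := spectrum.pow_nnnorm_pow_one_div_tendsto_nhds_spectralRadius N
  have hr2' : r < 1 := by exact_mod_cast hr2
  have hev : ∀ᶠ j : ℕ in atTop, ‖N ^ j‖ ≤ (r : ℝ) ^ j := by
    filter_upwards [hlim.eventually (gt_mem_nhds hr1), eventually_gt_atTop 0] with j hj hj0
    have h1 : ((‖N ^ j‖₊ : ℝ≥0∞) ^ (1 / (j : ℝ))) ^ (j : ℝ) ≤ (r : ℝ≥0∞) ^ (j : ℝ) :=
      ENNReal.rpow_le_rpow hj.le (Nat.cast_nonneg j)
    rw [← ENNReal.rpow_mul, one_div_mul_cancel (by positivity), ENNReal.rpow_one,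
      ENNReal.rpow_natCast] at h1
    have h2 : ‖N ^ j‖₊ ≤ r ^ j := by exact_mod_cast h1
    exact_mod_cast h2
  refine squeeze_zero_norm' hev ?_
  exact tendsto_pow_atTop_nhds_zero_of_lt_one r.2 (by exact_mod_cast hr2')

/-- The eigenvalues of `A⁻¹` are the inverses of those of `A`, hence of modulus below `1`. The
argument runs in complex matrices, where the spectrum is available. -/
theorem IsExpansiveDilation.tendsto_inv_pow {A : (Rd d →L[ℝ] Rd d)ˣ}
    (hA : IsExpansiveDilation A.val) :
    Tendsto (fun j : ℕ => ((A⁻¹) ^ j).val) atTop (𝓝 0) := by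
  set b := (EuclideanSpace.basisFun (Fin d) ℝ).toBasis with hb
  set mat : (Rd d →L[ℝ] Rd d) → Matrix (Fin d) (Fin d) ℂ := fun T =>
    (LinearMap.toMatrix b b (T : Rd d →ₗ[ℝ] Rd d)).map (algebraMap ℝ ℂ) with hmat
  have hmul : ∀ S T, mat (S * T) = mat S * mat T := by
    intro S T
    rw [hmat]
    simp only
    rw [← Matrix.map_mul, ← LinearMap.toMatrix_mul]
    rfl
  have hone : mat 1 = 1 := by
    rw [hmat]
    simp only
    have : (((1 : Rd d →L[ℝ] Rd d) : Rd d →L[ℝ] Rd d) : Rd d →ₗ[ℝ] Rd d) = 1 := rfl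
    rw [this, LinearMap.toMatrix_one, Matrix.map_one _ (map_zero _) (map_one _)]
  have hpow : ∀ T (j : ℕ), mat (T ^ j) = mat T ^ j := by
    intro T j
    induction j with
    | zero => rw [pow_zero, pow_zero, hone]
    | succ j ih => rw [pow_succ, pow_succ, hmul, ih]
  let u : (Matrix (Fin d) (Fin d) ℂ)ˣ :=
    ⟨mat A.val, mat (A⁻¹).val, by rw [← hmul, A.mul_inv, hone], by rw [← hmul, A.inv_mul, hone]⟩
  have hspec : ∀ z ∈ spectrum ℂ (mat (A⁻¹).val), ‖z‖ < 1 := by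
    intro z hz
    have hz0 : z ≠ 0 := spectrum.ne_zero_of_mem_of_unit (a := u⁻¹) hz
    have hz' : (((Units.mk0 z hz0)⁻¹ : ℂˣ) : ℂ) ∈ spectrum ℂ (u : Matrix (Fin d) (Fin d) ℂ) := by
      rw [spectrum.inv_mem_iff, inv_inv]
      exact hz
    have hroot := Matrix.mem_spectrum_iff_isRoot_charpoly.1 hz'
    have hch : (u : Matrix (Fin d) (Fin d) ℂ).charpoly =
        (A.val : Rd d →ₗ[ℝ] Rd d).charpoly.map (algebraMap ℝ ℂ) := by
      change (mat A.val).charpoly = _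
      rw [hmat]
      simp only
      rw [Matrix.charpoly_map, LinearMap.charpoly_toMatrix]
    rw [hch] at hroot
    have := hA.2 _ hroot
    rw [Units.val_inv_eq_inv_val, Units.val_mk0, norm_inv] at this
    by_contra hcon
    exact absurd this (not_lt.2 (inv_le_one_of_one_le₀ (not_lt.1 hcon)))
  have hlim := tendsto_matrix_pow_zero _ hspec
  -- Taking real parts is a continuous left inverse of complexification and carries the limit back
  -- to operators.
  let Φ : Matrix (Fin d) (Fin d) ℂ →ₗ[ℝ] (Rd d →L[ℝ] Rd d) :=
    (LinearMap.toContinuousLinearMap : (Rd d →ₗ[ℝ] Rd d) ≃ₗ[ℝ] _).toLinearMap ∘ₗ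
      (Matrix.toLin b b).toLinearMap ∘ₗ (Complex.reLm.mapMatrix)
  have hΦ : ∀ T, Φ (mat T) = T := by
    intro T
    have : Complex.reLm.mapMatrix (mat T) = LinearMap.toMatrix b b (T : Rd d →ₗ[ℝ] Rd d) := by
      ext i j
      simp [hmat]
    simp only [Φ, LinearMap.comp_apply, this, LinearEquiv.coe_coe, Matrix.toLin_toMatrix]
    rfl
  have hc : Continuous Φ := LinearMap.continuous_of_finiteDimensional Φ
  have := (hc.tendsto 0).comp hlim
  rw [map_zero] at this
  refine this.congr fun j => ?_
  rw [Function.comp, ← hpow, hΦ, Units.val_pow_eq_pow_val]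

end Gelfand

theorem IsExpansiveDilation.tendsto_star_inv_pow {A : (Rd d →L[ℝ] Rd d)ˣ}
    (hA : IsExpansiveDilation A.val) :
    Tendsto (fun j : ℕ => (((star A)⁻¹) ^ j).val) atTop (𝓝 0) := by
  have h := ((ContinuousLinearMap.adjoint (𝕜 := ℝ) (E := Rd d) (F := Rd d)).continuous.tendsto
    0).comp hA.tendsto_inv_pow
  rw [map_zero] at h
  refine h.congr fun j => ?_
  rw [Function.comp, ← ContinuousLinearMap.star_eq_adjoint, ← Units.coe_star, star_pow, star_inv]

/-- The lattices `A^{-j} ℤ^d` become dense. -/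
theorem IsExpansiveDilation.exists_tendsto_lattice {A : (Rd d →L[ℝ] Rd d)ˣ}
    (hA : IsExpansiveDilation A.val) (t : Rd d) :
    ∃ k : ℕ → Fin d → ℤ, Tendsto (fun j => ((A⁻¹) ^ j).val (intVec (k j))) atTop (𝓝 t) := by
  -- Round `A ^ j t` to the lattice: the error is at most `√d` and is then contracted by `A⁻ʲ`.
  refine ⟨fun j i => round (((A ^ j).val t) i), ?_⟩
  rw [tendsto_iff_norm_sub_tendsto_zero]
  have hbound : ∀ y : Rd d, ‖intVec (fun i => round (y i)) - y‖ ≤ √d := by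
    intro y
    rw [EuclideanSpace.norm_eq]
    refine Real.sqrt_le_sqrt ?_
    have : ∀ i, ‖(intVec (fun i => round (y i)) - y) i‖ ^ 2 ≤ 1 := by
      intro i
      have h1 : |y i - round (y i)| ≤ 1 / 2 := abs_sub_round (y i)
      have h2 : (intVec (fun i => round (y i)) - y) i = round (y i) - y i := rfl
      rw [h2, Real.norm_eq_abs, abs_sub_comm]
      nlinarith [abs_nonneg (y i - round (y i))]
    calc ∑ i, ‖(intVec (fun i => round (y i)) - y) i‖ ^ 2 ≤ ∑ _i : Fin d, (1 : ℝ) :=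
          Finset.sum_le_sum fun i _ => this i
      _ = d := by simp
  have hlim : Tendsto (fun j : ℕ => ‖((A⁻¹) ^ j).val‖ * √d) atTop (𝓝 0) := by
    simpa using hA.tendsto_inv_pow.norm.mul_const (√d)
  refine squeeze_zero (fun _ => norm_nonneg _) (fun j => ?_) hlim
  have h1 : ((A⁻¹) ^ j).val ((A ^ j).val t) = t := by
    rw [inv_pow]
    exact unit_inv_apply (A ^ j) t
  calc ‖((A⁻¹) ^ j).val (intVec fun i => round (((A ^ j).val t) i)) - t‖
      = ‖((A⁻¹) ^ j).val ((intVec fun i => round (((A ^ j).val t) i)) - (A ^ j).val t)‖ := by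
        rw [map_sub, h1]
    _ ≤ _ := (ContinuousLinearMap.le_opNorm _ _).trans
        (mul_le_mul_of_nonneg_left (hbound _) (norm_nonneg _))

end ShiftInv

end

noncomputable section

namespace ShiftInv

variable {d : ℕ}

/-! ### Existence of tight frame generators -/

theorem hasSum_prod_of_nonneg {α β : Type*} {f : α × β → ℝ} (hf : ∀ p, 0 ≤ f p) {g : α → ℝ}
    {s : ℝ} (h1 : ∀ a, HasSum (fun b => f (a, b)) (g a)) (h2 : HasSum g s) : HasSum f s := by
  have hs : Summable f := (summable_prod_of_nonneg hf).2
    ⟨fun a => (h1 a).summable, h2.summable.congr fun a => (h1 a).tsum_eq.symm⟩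
  have := hs.hasSum.prod_fiberwise h1
  rw [h2.unique this]
  exact hs.hasSum

theorem inner_shift_right (t : Rd d) (f g : L2 d) :
    inner ℂ f (shift t g) = inner ℂ (shift (-t) f) g := by
  rw [inner_shift_eq_integral, ← inner_conj_symm, inner_shift_eq_integral, ← integral_conj]
  refine integral_congr_ae (Eventually.of_forall fun ξ => ?_)
  simp only [map_mul, Complex.conj_conj]
  have : starRingEnd ℂ (character (-t) ξ) = character t ξ := by
    rw [character, character, inner_neg_left, neg_neg, AddChar.map_neg_eq_inv, Circle.coe_inv_eq_conj]
  rw [this]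
  ring

theorem intVec_neg (k : Fin d → ℤ) : intVec (-k) = -intVec k := by
  ext i
  simp [intVec]

theorem shift_zero (f : L2 d) : shift (intVec 0) f = f := by
  have h0 : intVec (0 : Fin d → ℤ) = 0 := by
    ext i
    simp [intVec]
  rw [h0]
  apply Lp.ext
  filter_upwards [coeFn_shift 0 f] with x hx
  rw [hx, sub_zero]

theorem pairwise_disjoint_unitCube :
    Pairwise (Function.onFun Disjoint fun k : Fin d → ℤ => unitCube fun i => (k i : ℝ)) := by
  intro k l hkl
  refine Set.disjoint_left.2 fun x hx hx' => hkl (funext fun i => ?_)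
  have h1 := hx i
  have h2 := hx' i
  have a : (k i : ℝ) < l i + 1 := lt_of_lt_of_le h1.1 h2.2
  have b : (l i : ℝ) < k i + 1 := lt_of_lt_of_le h2.1 h1.2
  have a' : k i < l i + 1 := by exact_mod_cast a
  have b' : l i < k i + 1 := by exact_mod_cast b
  lia

theorem iUnion_unitCube : ⋃ k : Fin d → ℤ, unitCube (fun i => (k i : ℝ)) = Set.univ := by
  refine Set.eq_univ_of_forall fun x => Set.mem_iUnion.2 ⟨fun i => ⌈x i⌉ - 1, fun i => ?_⟩
  have h1 := Int.le_ceil (x i)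
  have h2 := Int.ceil_lt_add_one (x i)
  push_cast
  constructor <;> linarith

theorem volume_unitCube (a : Fin d → ℝ) : volume (unitCube a) = 1 := by
  have h := (PiLp.volume_preserving_toLp (Fin d)).measure_preimage
    (measurableSet_unitCube a).nullMeasurableSet
  have h2 : (WithLp.toLp 2) ⁻¹' (unitCube a) =
      Set.univ.pi fun i => Set.Ioc (a i) (a i + 1) := by
    ext x
    simp [unitCube]
  rw [← h, h2, Real.volume_pi_Ioc]
  simp

/-- The functions whose Fourier transforms are the indicator functions of the unit cubes with
integer corners. -/
def cubeFunction (k : Fin d → ℤ) : L2 d :=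
  fourierIndicator (unitCube fun i => (k i : ℝ)) (measurableSet_unitCube _)
    (by rw [volume_unitCube]; exact ENNReal.one_ne_top)

/-- Parseval on each cube gives the integral of `|f̂|²` over that cube, and the cubes tile the
space. -/
theorem hasSum_inner_cubeFunction (f : L2 d) : HasSum
    (fun p : (Fin d → ℤ) × (Fin d → ℤ) =>
      ‖inner ℂ f (shift (intVec p.2) (cubeFunction p.1))‖ ^ 2) (‖f‖ ^ 2) := by
  refine hasSum_prod_of_nonneg (fun p => sq_nonneg _)
    (g := fun c => ∫ ξ in unitCube (fun i => (c i : ℝ)), ‖(𝓕 f : L2 d) ξ‖ ^ 2) (fun c => ?_) ?_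
  · set Q := unitCube fun i => (c i : ℝ)
    have hQ : MeasurableSet Q := measurableSet_unitCube _
    have h := hasSum_sq_integral_character (fun i => (c i : ℝ))
      -- The conjugate appears because `f` sits in the conjugate-linear slot of the inner product.
      (h := Q.indicator fun ξ => starRingEnd ℂ ((𝓕 f : L2 d) ξ))
      ((Lp.memLp _).star.indicator hQ) (fun ξ hξ => Set.indicator_of_notMem hξ _)
    have e1 : ∫ ξ, ‖Q.indicator (fun ξ => starRingEnd ℂ ((𝓕 f : L2 d) ξ)) ξ‖ ^ 2 =
        ∫ ξ in Q, ‖(𝓕 f : L2 d) ξ‖ ^ 2 := by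
      rw [← integral_indicator hQ]
      refine integral_congr_ae (Eventually.of_forall fun ξ => ?_)
      by_cases hξ : ξ ∈ Q <;> simp [hξ]
    rw [e1] at h
    refine h.congr_fun fun k => ?_
    congr 2
    rw [inner_shift_eq_integral, cubeFunction, fourier_fourierIndicator]
    refine integral_congr_ae ?_
    filter_upwards [indicatorConstLp_coeFn (p := 2) (hs := hQ) (c := (1 : ℂ))
      (hμs := by rw [volume_unitCube]; exact ENNReal.one_ne_top)] with ξ hξ
    rw [hξ]
    by_cases hξ' : ξ ∈ Q <;> simp [hξ']
  · have hint : Integrable (fun ξ => ‖(𝓕 f : L2 d) ξ‖ ^ 2) :=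
      (memLp_two_iff_integrable_sq_norm (Lp.aestronglyMeasurable _)).1 (Lp.memLp _)
    have := hasSum_integral_iUnion (μ := (volume : Measure (Rd d)))
      (f := fun ξ => ‖(𝓕 f : L2 d) ξ‖ ^ 2)
      (fun k : Fin d → ℤ => measurableSet_unitCube fun i => (k i : ℝ))
      pairwise_disjoint_unitCube hint.integrableOn
    rw [iUnion_unitCube, setIntegral_univ, ← norm_sq_eq_integral, Lp.norm_fourier_eq] at this
    exact this

theorem inner_starProjection_left {V : Submodule ℂ (L2 d)} [V.HasOrthogonalProjection] (f : L2 d)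
    {v : L2 d} (hv : v ∈ V) : inner ℂ (V.starProjection f) v = inner ℂ f v := by
  rw [Submodule.inner_starProjection_left_eq_right, Submodule.starProjection_eq_self_iff.2 hv]

/-- For `f ∈ V` shift-invariance lets the projection pass from the cube function to the shifted `f`,
which it fixes; so the frame identity on all of `L²` restricts to `V`. -/
theorem isTightFrameGenerator_starProjection {V : Submodule ℂ (L2 d)}
    [V.HasOrthogonalProjection] (hV : IsShiftInvariant V) :
    IsTightFrameGenerator V fun k : Fin d → ℤ => V.starProjection (cubeFunction k) := by
  refine ⟨fun k => Submodule.starProjection_apply_mem _ _, fun f hf => ?_⟩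
  refine (hasSum_inner_cubeFunction f).congr_fun fun p => ?_
  congr 2
  rw [inner_shift_right, inner_shift_right, ← Submodule.inner_starProjection_left_eq_right,
    Submodule.starProjection_eq_self_iff.2]
  rw [← intVec_neg]
  exact hV.2 f hf _

theorem exists_isSpectralFunction {V : Submodule ℂ (L2 d)} [V.HasOrthogonalProjection]
    (hV : IsShiftInvariant V) : ∃ σ : Rd d → ℝ, IsSpectralFunction V σ :=
  ⟨_, _, _, isTightFrameGenerator_starProjection hV, EventuallyEq.rfl⟩

/-! ### Properties of tight frame generators -/

section TightFrame

variable {V : Submodule ℂ (L2 d)} [V.HasOrthogonalProjection] {ι : Type} {φ : ι → L2 d}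

theorem IsTightFrameGenerator.hasSum_starProjection (hV : IsShiftInvariant V)
    (hφ : IsTightFrameGenerator V φ) (f : L2 d) :
    HasSum (fun p : ι × (Fin d → ℤ) => ‖inner ℂ f (shift (intVec p.2) (φ p.1))‖ ^ 2)
      (‖V.starProjection f‖ ^ 2) := by
  refine (hφ.2 _ (Submodule.starProjection_apply_mem V f)).congr_fun fun p => ?_
  rw [inner_starProjection_left f (hV.2 _ (hφ.1 _) _)]

/-- A summable family has countable support. Pairing with each member of a dense sequence, already
at `k = 0`, detects every nonzero generator. Countability is needed to sum integrals and to combine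
a.e. statements. -/
theorem IsTightFrameGenerator.countable (hV : IsShiftInvariant V)
    (hφ : IsTightFrameGenerator V φ) : {α | φ α ≠ 0}.Countable := by
  have : Fact ((2 : ℝ≥0∞) ≠ ⊤) := ⟨ENNReal.ofNat_ne_top⟩
  set u := TopologicalSpace.denseSeq (L2 d)
  have h1 : ∀ n, {α | inner ℂ (u n) (φ α) ≠ 0}.Countable := by
    intro n
    have := (hφ.hasSum_starProjection hV (u n)).summable.countable_support
    refine (this.image Prod.fst).mono fun α hα => ?_
    refine ⟨(α, 0), ?_, rfl⟩
    simp only [Function.mem_support, shift_zero]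
    exact pow_ne_zero _ (norm_ne_zero_iff.2 hα)
  refine (Set.countable_iUnion h1).mono fun α hα => ?_
  by_contra hcon
  have hz : ∀ n, inner ℂ (u n) (φ α) = 0 := by
    intro n
    by_contra h
    exact hcon (Set.mem_iUnion.2 ⟨n, h⟩)
  exact hα ((TopologicalSpace.denseRange_denseSeq (L2 d)).eq_zero_of_inner_right ℂ hz)

theorem IsSpectralFunction.exists_countable (hV : IsShiftInvariant V) {σ : Rd d → ℝ}
    (hσ : IsSpectralFunction V σ) :
    ∃ (ι : Type) (_ : Countable ι) (φ : ι → L2 d), IsTightFrameGenerator V φ ∧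
      σ =ᵐ[volume] fun ξ => ∑' α, ‖(𝓕 (φ α) : L2 d) ξ‖ ^ 2 := by
  obtain ⟨ι, φ, hφ, hs⟩ := hσ
  have hc := hφ.countable hV
  refine ⟨{α | φ α ≠ 0}, hc.to_subtype, fun α => φ α, ⟨fun α => hφ.1 _, fun f hf => ?_⟩, ?_⟩
  · have hinj : Function.Injective
        (Prod.map Subtype.val id : {α | φ α ≠ 0} × (Fin d → ℤ) → ι × (Fin d → ℤ)) :=
      Subtype.val_injective.prodMap Function.injective_id
    refine (hinj.hasSum_iff ?_).2 (hφ.2 f hf)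
    rintro ⟨α, k⟩ hα
    have : φ α = 0 := by
      by_contra h
      exact hα ⟨(⟨α, h⟩, k), rfl⟩
    have h0 : shift (intVec k) (0 : L2 d) = 0 := map_zero (Lp.compMeasurePreserving _ _)
    simp [this, h0]
  · have h0 : ((𝓕 (0 : L2 d) : L2 d)) = 0 := map_zero (Lp.fourierTransformₗᵢ (Rd d) ℂ)
    filter_upwards [hs, Lp.coeFn_zero ℂ 2 (volume : Measure (Rd d))] with ξ h1 h2
    rw [h1]
    refine (tsum_subtype_eq_of_support_subset fun α hα => ?_).symm
    intro h
    refine hα ?_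
    simp only [h, h0, h2]
    simp

/-- The central formula. Summing over `k` gives the integral of one `|φ̂^α|²`, summing over `α`
gives the frame sum. The right side no longer involves the generator. -/
theorem IsTightFrameGenerator.lintegral_eq [Countable ι] (hV : IsShiftInvariant V)
    (hφ : IsTightFrameGenerator V φ) {E : Set (Rd d)} (hE : MeasurableSet E)
    (hE' : volume E ≠ ⊤) {c : Rd d} (hc : E ⊆ Metric.ball c (1 / 2)) :
    ∫⁻ ξ in E, ∑' α, ENNReal.ofReal (‖(𝓕 (φ α) : L2 d) ξ‖ ^ 2) =
      ENNReal.ofReal (‖V.starProjection (fourierIndicator E hE hE')‖ ^ 2) := by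
  have hm : ∀ α, Integrable (fun ξ => ‖(𝓕 (φ α) : L2 d) ξ‖ ^ 2) := fun α =>
    (memLp_two_iff_integrable_sq_norm (Lp.aestronglyMeasurable _)).1 (Lp.memLp _)
  have hsum := (hφ.hasSum_starProjection hV (fourierIndicator E hE hE')).prod_fiberwise
    fun α => hasSum_inner_fourierIndicator hE hE' hc (φ α)
  rw [lintegral_tsum fun α => (hm α).aestronglyMeasurable.aemeasurable.ennreal_ofReal.restrict]
  rw [← hsum.tsum_eq, ENNReal.ofReal_tsum_of_nonneg
    (fun α => integral_nonneg fun ξ => sq_nonneg _) hsum.summable]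
  refine tsum_congr fun α => ?_
  rw [ofReal_integral_eq_lintegral_ofReal (hm α).integrableOn
    (Eventually.of_forall fun ξ => sq_nonneg _)]

theorem IsTightFrameGenerator.lintegral_le [Countable ι] (hV : IsShiftInvariant V)
    (hφ : IsTightFrameGenerator V φ) {E : Set (Rd d)} (hE : MeasurableSet E)
    {c : Rd d} (hc : E ⊆ Metric.ball c (1 / 2)) :
    ∫⁻ ξ in E, ∑' α, ENNReal.ofReal (‖(𝓕 (φ α) : L2 d) ξ‖ ^ 2) ≤ volume E := by
  have hE' : volume E ≠ ⊤ := ((measure_mono hc).trans_lt measure_ball_lt_top).ne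
  rw [hφ.lintegral_eq hV hE hE' hc, ← ENNReal.ofReal_toReal hE']
  refine ENNReal.ofReal_le_ofReal ?_
  change _ ≤ volume.real E
  rw [← norm_sq_fourierIndicator E hE hE']
  have := Submodule.norm_starProjection_apply_le V (fourierIndicator E hE hE')
  gcongr

/-- An inequality between a.e. measurable functions follows from the inequality between their
integrals over all measurable subsets of small balls. -/
theorem ae_le_of_forall_setLIntegral_le_ball {f g : Rd d → ℝ≥0∞} (hf : AEMeasurable f volume)
    {r : ℝ} (hr : 0 < r) (h : ∀ (c : Rd d) (E : Set (Rd d)), MeasurableSet E →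
      E ⊆ Metric.ball c r → ∫⁻ ξ in E, f ξ ≤ ∫⁻ ξ in E, g ξ) : f ≤ᵐ[volume] g := by
  -- Only sets in small balls can be tested, which is enough because a locally null set is null.
  change volume {ξ | ¬ f ξ ≤ g ξ} = 0
  refine measure_null_of_locally_null _ fun x _ => ⟨{ξ | ¬ f ξ ≤ g ξ} ∩ Metric.ball x r,
    inter_mem_nhdsWithin _ (Metric.ball_mem_nhds x hr), ?_⟩
  have h1 : f ≤ᵐ[volume.restrict (Metric.ball x r)] g := by
    refine ae_le_of_forall_setLIntegral_le_of_sigmaFinite₀ hf.restrict fun s hs _ => ?_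
    rw [Measure.restrict_restrict hs]
    exact h x _ (hs.inter measurableSet_ball) Set.inter_subset_right
  have h2 := (ae_restrict_iff' measurableSet_ball).1 h1
  refine measure_mono_null ?_ h2
  rintro ξ ⟨h3, h4⟩ h5
  exact h3 (h5 h4)

/-- The analytic properties of a spectral function on which everything else rests. -/
structure IsSpectralData (V : Submodule ℂ (L2 d)) [V.HasOrthogonalProjection] {ι : Type}
    (φ : ι → L2 d) (σ : Rd d → ℝ) : Prop where
  tight : IsTightFrameGenerator V φ
  aemeasurable : AEMeasurable σ volume
  mem_Icc : ∀ᵐ ξ, σ ξ ∈ Set.Icc (0 : ℝ) 1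
  eq_zero_iff : ∀ᵐ ξ, σ ξ = 0 ↔ ∀ α, (𝓕 (φ α) : L2 d) ξ = 0
  lintegral_eq : ∀ (E : Set (Rd d)) (hE : MeasurableSet E) (hE' : volume E ≠ ⊤) (c : Rd d),
    E ⊆ Metric.ball c (1 / 2) → ∫⁻ ξ in E, ENNReal.ofReal (σ ξ) =
      ENNReal.ofReal (‖V.starProjection (fourierIndicator E hE hE')‖ ^ 2)

theorem IsSpectralFunction.exists_isSpectralData (hV : IsShiftInvariant V) {σ : Rd d → ℝ}
    (hσ : IsSpectralFunction V σ) :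
    ∃ (ι : Type) (_ : Countable ι) (φ : ι → L2 d), IsSpectralData V φ σ := by
  obtain ⟨ι, hι, φ, hφ, hs⟩ := hσ.exists_countable hV
  have hmα : ∀ α, Measurable fun ξ => ENNReal.ofReal (‖(𝓕 (φ α) : L2 d) ξ‖ ^ 2) := fun α =>
    (((Lp.stronglyMeasurable _).norm.measurable).pow_const 2).ennreal_ofReal
  have hm : Measurable fun ξ => ∑' α, ENNReal.ofReal (‖(𝓕 (φ α) : L2 d) ξ‖ ^ 2) :=
    Measurable.tsum hmα
  have hle : (fun ξ => ∑' α, ENNReal.ofReal (‖(𝓕 (φ α) : L2 d) ξ‖ ^ 2)) ≤ᵐ[volume] fun _ => 1 := by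
    refine ae_le_of_forall_setLIntegral_le_ball hm.aemeasurable
      (r := 1 / 2) (by norm_num) fun c E hE hc => ?_
    rw [setLIntegral_one]
    exact hφ.lintegral_le hV hE hc
  -- The bound by `1` makes the real `tsum` a genuine sum; without summability it would be `0` by
  -- default.
  have hsummable : ∀ᵐ ξ, Summable fun α => ‖(𝓕 (φ α) : L2 d) ξ‖ ^ 2 := by
    filter_upwards [hle] with ξ hξ
    have := ENNReal.summable_toReal (ne_top_of_le_ne_top ENNReal.one_ne_top hξ)
    simpa only [ENNReal.toReal_ofReal (sq_nonneg _)] using this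
  have heq : ∀ᵐ ξ, ENNReal.ofReal (σ ξ) = ∑' α, ENNReal.ofReal (‖(𝓕 (φ α) : L2 d) ξ‖ ^ 2) := by
    filter_upwards [hs, hsummable] with ξ h1 h2
    rw [h1, ENNReal.ofReal_tsum_of_nonneg (fun α => sq_nonneg _) h2]
  have hnonneg : ∀ᵐ ξ, 0 ≤ σ ξ := by
    filter_upwards [hs] with ξ h1
    rw [h1]
    exact tsum_nonneg fun α => sq_nonneg _
  refine ⟨ι, hι, φ, hφ, ?_, ?_, ?_, ?_⟩
  · refine ⟨fun ξ => (∑' α, ENNReal.ofReal (‖(𝓕 (φ α) : L2 d) ξ‖ ^ 2)).toReal,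
      hm.ennreal_toReal, ?_⟩
    filter_upwards [heq, hnonneg] with ξ h1 h2
    rw [← h1, ENNReal.toReal_ofReal h2]
  · filter_upwards [heq, hnonneg, hle] with ξ h1 h2 h3
    rw [← h1] at h3
    exact ⟨h2, ENNReal.ofReal_le_one.1 h3⟩
  · filter_upwards [hs, hsummable] with ξ h1 h2
    rw [h1, ← h2.hasSum_iff, hasSum_zero_iff_of_nonneg fun α => sq_nonneg _, funext_iff]
    simp
  · intro E hE hE' c hc
    rw [← hφ.lintegral_eq hV hE hE' hc]
    exact lintegral_congr_ae (ae_restrict_of_ae heq)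

end TightFrame

/-- A tight frame generator generates. -/
theorem IsTightFrameGenerator.generates {V : Submodule ℂ (L2 d)} {ι : Type}
    {φ : ι → L2 d} (hV : IsShiftInvariant V)
    (hφ : IsTightFrameGenerator V φ) : Generates (Set.range φ) V := by
  refine ⟨by rintro _ ⟨α, rfl⟩; exact hφ.1 α, fun f hf => ?_⟩
  set S := {g : L2 d | ∃ ψ ∈ Set.range φ, ∃ k : Fin d → ℤ, g = shift (intVec k) ψ}
  set M := (Submodule.span ℂ S).topologicalClosure with hM
  have hMV : M ≤ V := by
    refine Submodule.topologicalClosure_minimal _ (Submodule.span_le.2 ?_) hV.1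
    rintro _ ⟨_, ⟨α, rfl⟩, k, rfl⟩
    exact hV.2 _ (hφ.1 α) k
  have : CompleteSpace M :=
    (Submodule.isClosed_topologicalClosure (Submodule.span ℂ S)).completeSpace_coe
  have hP : M.starProjection f ∈ M := Submodule.starProjection_apply_mem _ _
  -- The part of `f` orthogonal to the closed span has vanishing frame coefficients, so the frame
  -- identity makes its norm zero.
  have hres : f - M.starProjection f ∈ V := V.sub_mem hf (hMV hP)
  have hsum := hφ.2 _ hres
  have hzero : ∀ p : ι × (Fin d → ℤ),
      ‖inner ℂ (f - M.starProjection f) (shift (intVec p.2) (φ p.1))‖ ^ 2 = 0 := by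
    intro p
    have hmem : shift (intVec p.2) (φ p.1) ∈ M :=
      Submodule.le_topologicalClosure _ (Submodule.subset_span ⟨_, ⟨p.1, rfl⟩, p.2, rfl⟩)
    rw [inner_sub_left, inner_starProjection_left f hmem, sub_self, norm_zero]
    norm_num
  simp_rw [hzero] at hsum
  have h0 : ‖f - M.starProjection f‖ ^ 2 = 0 := hsum.unique hasSum_zero
  have h1 : f = M.starProjection f := by
    rw [← sub_eq_zero, ← norm_eq_zero]
    exact pow_eq_zero_iff (two_ne_zero) |>.1 h0
  change f ∈ M
  rw [h1]
  exact hP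

end ShiftInv

end

noncomputable section

namespace ShiftInv

variable {d : ℕ}

/-! ### Powers of dilations -/

theorem powMap_powMap (B : (Rd d →L[ℝ] Rd d)ˣ) (i j : ℤ) (x : Rd d) :
    powMap B i (powMap B j x) = powMap B (i + j) x := by
  rw [powMap, powMap, powMap, zpow_add]
  rfl

theorem powMap_zero (B : (Rd d →L[ℝ] Rd d)ˣ) (x : Rd d) : powMap B 0 x = x := by
  rw [powMap, zpow_zero]
  rfl

theorem powMap_neg_natCast (B : (Rd d →L[ℝ] Rd d)ˣ) (j : ℕ) (x : Rd d) :
    powMap B (-(j : ℤ)) x = ((B⁻¹) ^ j).val x := by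
  rw [powMap, zpow_neg, zpow_natCast, inv_pow]

theorem powMap_inv (B : (Rd d →L[ℝ] Rd d)ˣ) (j : ℤ) (x : Rd d) :
    powMap B⁻¹ j x = powMap B (-j) x := by
  rw [powMap, powMap, inv_zpow, zpow_neg]

theorem powMap_neg_powMap (B : (Rd d →L[ℝ] Rd d)ˣ) (j : ℤ) (x : Rd d) :
    powMap B (-j) (powMap B j x) = x := by
  rw [powMap_powMap, neg_add_cancel, powMap_zero]

theorem powMap_powMap_neg (B : (Rd d →L[ℝ] Rd d)ˣ) (j : ℤ) (x : Rd d) :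
    powMap B j (powMap B (-j) x) = x := by
  rw [powMap_powMap, add_neg_cancel, powMap_zero]

theorem powMap_image (B : (Rd d →L[ℝ] Rd d)ˣ) (j : ℤ) (E : Set (Rd d)) :
    powMap B j '' E = powMap B (-j) ⁻¹' E :=
  congrFun (Set.image_eq_preimage_of_inverse (powMap_neg_powMap B j) (powMap_powMap_neg B j)) E

theorem measurable_powMap (B : (Rd d →L[ℝ] Rd d)ˣ) (j : ℤ) : Measurable (powMap B j) :=
  (B ^ j).val.continuous.measurable

theorem quasiMeasurePreserving_powMap (B : (Rd d →L[ℝ] Rd d)ˣ) (j : ℤ) :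
    Measure.QuasiMeasurePreserving (powMap B j) volume volume := quasiMeasurePreserving (B ^ j)

theorem volume_preimage_unit (C : (Rd d →L[ℝ] Rd d)ˣ) (E : Set (Rd d)) :
    volume (C.val ⁻¹' E) = ENNReal.ofReal (absDet C)⁻¹ * volume E := by
  have h := congrArg (fun μ => μ E) (map_unit_volume C)
  simpa [(measurableEmbedding_unit C).map_apply] using h

theorem volume_powMap_image (B : (Rd d →L[ℝ] Rd d)ˣ) (j : ℤ) (E : Set (Rd d)) :
    volume (powMap B j '' E) = ENNReal.ofReal (absDet (B ^ j)) * volume E := by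
  rw [powMap_image]
  have := volume_preimage_unit (B ^ (-j)) E
  rw [zpow_neg, absDet_inv, inv_inv] at this
  rw [← this, ← zpow_neg]
  rfl

theorem volumeReal_powMap_image (B : (Rd d →L[ℝ] Rd d)ˣ) (j : ℤ) (E : Set (Rd d)) :
    volume.real (powMap B j '' E) = absDet (B ^ j) * volume.real E := by
  rw [Measure.real, volume_powMap_image, ENNReal.toReal_mul,
    ENNReal.toReal_ofReal (absDet_pos _).le]
  rfl

theorem dilate_dilate (A C : (Rd d →L[ℝ] Rd d)ˣ) (f : L2 d) :
    dilate A (dilate C f) = dilate (C * A) f := by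
  apply Lp.ext
  filter_upwards [coeFn_dilate A (dilate C f), (quasiMeasurePreserving A).ae (coeFn_dilate C f),
    coeFn_dilate (C * A) f] with x h1 h2 h3
  rw [h1, h2, h3, absDet_mul, Real.sqrt_mul (absDet_pos C).le, Complex.ofReal_mul, ← mul_assoc,
    mul_comm ((√(absDet A) : ℝ) : ℂ)]
  rfl

theorem dilation_zpow (A : (Rd d →L[ℝ] Rd d)ˣ) (j : ℤ) (f : L2 d) :
    (dilation A ^ j) f = dilate (A ^ j) f := by
  have hnat : ∀ (n : ℕ) (f : L2 d), (dilation A ^ n) f = dilate (A ^ n) f := by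
    intro n
    induction n with
    | zero =>
      intro f
      have h := dilate_inv 1 1 (one_mul _) f
      rw [dilate_dilate, one_mul] at h
      rw [pow_zero, pow_zero, h]
      rfl
    | succ n ih =>
      intro f
      rw [pow_succ, LinearEquiv.mul_apply, ih, pow_succ', ← dilate_dilate]
      rfl
  obtain ⟨n, rfl | rfl⟩ := j.eq_nat_or_neg
  · rw [zpow_natCast, zpow_natCast, hnat]
  · rw [zpow_neg, zpow_neg, zpow_natCast, zpow_natCast]
    refine (LinearEquiv.symm_apply_eq (dilation A ^ n)).2 ?_
    rw [hnat]
    exact (dilate_inv (A ^ n)⁻¹ (A ^ n) (inv_mul_cancel _) f).symm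

theorem star_zpow_unit (A : (Rd d →L[ℝ] Rd d)ˣ) (j : ℤ) : star (A ^ j) = star A ^ j :=
  star_zpow A j

theorem coeFn_fourier_dilate_zpow (A : (Rd d →L[ℝ] Rd d)ˣ) (j : ℤ) (f : L2 d) :
    (𝓕 (dilate (A ^ j) f) : L2 d) =ᵐ[volume] fun ξ =>
      ((√(absDet (star A ^ (-j))) : ℝ) : ℂ) * (𝓕 f : L2 d) (powMap (star A) (-j) ξ) := by
  rw [fourier_dilate, star_zpow_unit, ← zpow_neg]
  exact coeFn_dilate _ _

theorem sqrt_absDet_ne_zero (C : (Rd d →L[ℝ] Rd d)ˣ) : ((√(absDet C) : ℝ) : ℂ) ≠ 0 := by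
  exact_mod_cast (Real.sqrt_pos.2 (absDet_pos C)).ne'

theorem dilate_inv_fourierIndicator (C : (Rd d →L[ℝ] Rd d)ˣ) {E : Set (Rd d)}
    (hE : MeasurableSet E) (hE' : volume E ≠ ⊤) (hC : MeasurableSet ((star C).val ⁻¹' E))
    (hC' : volume ((star C).val ⁻¹' E) ≠ ⊤) :
    dilate C⁻¹ (fourierIndicator E hE hE') =
      ((√(absDet C) : ℝ) : ℂ) • fourierIndicator ((star C).val ⁻¹' E) hC hC' := by
  apply (Lp.fourierTransformₗᵢ (Rd d) ℂ).injective
  rw [map_smul]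
  change (𝓕 (dilate C⁻¹ (fourierIndicator E hE hE')) : L2 d) =
    _ • (𝓕 (fourierIndicator _ hC hC') : L2 d)
  rw [fourier_dilate, fourier_fourierIndicator, fourier_fourierIndicator, star_inv, inv_inv]
  apply Lp.ext
  have h2 : ∀ᵐ ξ : Rd d, indicatorConstLp 2 hE hE' (1 : ℂ) ξ = E.indicator (fun _ => 1) ξ :=
    indicatorConstLp_coeFn
  filter_upwards [coeFn_dilate (star C) (indicatorConstLp 2 hE hE' (1 : ℂ)),
    Lp.coeFn_smul ((√(absDet C) : ℝ) : ℂ) (indicatorConstLp 2 hC hC' (1 : ℂ)),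
    (quasiMeasurePreserving (star C)).ae h2,
    indicatorConstLp_coeFn (p := 2) (hs := hC) (hμs := hC') (c := (1 : ℂ))] with ξ h1 h2 h3 h4
  rw [h1, h2, h3, Pi.smul_apply, h4, absDet_star]
  rfl

/-! ### Monotonicity of the spectral function along the orbits of the dilation -/

section Monotone

variable {V : Submodule ℂ (L2 d)} [V.HasOrthogonalProjection] {ι : Type} {φ : ι → L2 d}
  {σ : Rd d → ℝ}

theorem volume_preimage_ne_top (C : (Rd d →L[ℝ] Rd d)ˣ) {E : Set (Rd d)} (hE : volume E ≠ ⊤) :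
    volume (C.val ⁻¹' E) ≠ ⊤ := by
  rw [volume_preimage_unit]
  exact ENNReal.mul_ne_top ENNReal.ofReal_ne_top hE

theorem setLIntegral_comp_unit_inv (C : (Rd d →L[ℝ] Rd d)ˣ) {E : Set (Rd d)}
    (hE : MeasurableSet E) (g : Rd d → ℝ≥0∞) :
    ∫⁻ ξ in E, g ((C⁻¹).val ξ) = ENNReal.ofReal (absDet C) * ∫⁻ ξ in C.val ⁻¹' E, g ξ := by
  have hC : MeasurableSet (C.val ⁻¹' E) := hE.preimage C.val.continuous.measurable
  rw [← lintegral_indicator hE, ← lintegral_indicator hC]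
  have h := lintegral_comp_unit C (E.indicator fun ξ => g ((C⁻¹).val ξ))
  have h2 : ∀ ξ, E.indicator (fun ξ => g ((C⁻¹).val ξ)) (C.val ξ) =
      (C.val ⁻¹' E).indicator g ξ := by
    intro ξ
    by_cases hξ : C.val ξ ∈ E
    · rw [Set.indicator_of_mem hξ, Set.indicator_of_mem (show ξ ∈ C.val ⁻¹' E from hξ),
        unit_inv_apply]
    · rw [Set.indicator_of_notMem hξ, Set.indicator_of_notMem (show ξ ∉ C.val ⁻¹' E from hξ)]
  simp_rw [h2] at h
  rw [h, ← mul_assoc, ← ENNReal.ofReal_mul (absDet_pos C).le,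
    mul_inv_cancel₀ (absDet_pos C).ne', ENNReal.ofReal_one, one_mul]

/-- Rescaled central formula. Only the preimage of `E` must be small, so a large bounded `E` is
admissible once `C` is a high power of an expansive map. -/
theorem IsSpectralData.lintegral_comp_eq (h : IsSpectralData V φ σ) (C : (Rd d →L[ℝ] Rd d)ˣ)
    {E : Set (Rd d)} (hE : MeasurableSet E) (hE' : volume E ≠ ⊤) {c : Rd d}
    (hc : (star C).val ⁻¹' E ⊆ Metric.ball c (1 / 2)) :
    ∫⁻ ξ in E, ENNReal.ofReal (σ (((star C)⁻¹).val ξ)) =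
      ENNReal.ofReal (‖V.starProjection (dilate C⁻¹ (fourierIndicator E hE hE'))‖ ^ 2) := by
  have hC : MeasurableSet ((star C).val ⁻¹' E) := hE.preimage (star C).val.continuous.measurable
  have hC' := volume_preimage_ne_top (star C) hE'
  rw [setLIntegral_comp_unit_inv (star C) hE fun ξ => ENNReal.ofReal (σ ξ),
    h.lintegral_eq _ hC hC' c hc, dilate_inv_fourierIndicator C hE hE' hC hC', map_smul,
    norm_smul, mul_pow, Complex.norm_real, Real.norm_eq_abs, sq_abs,
    Real.sq_sqrt (absDet_pos C).le, ENNReal.ofReal_mul (absDet_pos C).le, absDet_star]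

/-- Write `P f = 𝒟_A v` with `v ∈ V`. Then `‖P f‖² = ⟨𝒟_A⁻¹ f, v⟩ = ⟨P 𝒟_A⁻¹ f, v⟩`, and `‖v‖ = ‖P
f‖`, so Cauchy–Schwarz finishes. -/
theorem IsRefinable.norm_starProjection_le {A : (Rd d →L[ℝ] Rd d)ˣ} (hVA : IsRefinable A V)
    (f : L2 d) : ‖V.starProjection f‖ ≤ ‖V.starProjection (dilate A⁻¹ f)‖ := by
  obtain ⟨v, hv, hvf⟩ := hVA (Submodule.starProjection_apply_mem V f)
  have hvf' : dilate A v = V.starProjection f := hvf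
  have hinv : dilate A (dilate A⁻¹ f) = f := dilate_inv A⁻¹ A (inv_mul_cancel A) f
  have h1 : inner ℂ (V.starProjection f) (V.starProjection f) =
      inner ℂ (V.starProjection (dilate A⁻¹ f)) v := by
    rw [inner_starProjection_left f (Submodule.starProjection_apply_mem V f),
      inner_starProjection_left _ hv, ← (dilationₗᵢ A).inner_map_map (dilate A⁻¹ f) v, ← hvf']
    conv_lhs => rw [← hinv]
    rfl
  have h2 : ‖V.starProjection f‖ * ‖V.starProjection f‖ ≤
      ‖V.starProjection (dilate A⁻¹ f)‖ * ‖V.starProjection f‖ := by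
    rw [← inner_self_eq_norm_mul_norm (𝕜 := ℂ), h1]
    refine (RCLike.re_le_norm _).trans ((norm_inner_le_norm _ _).trans_eq ?_)
    rw [← hvf', norm_dilate]
  rcases (norm_nonneg (V.starProjection f)).eq_or_lt with h0 | h0
  · rw [← h0]
    exact norm_nonneg _
  · exact le_of_mul_le_mul_right h2 h0

/-- The central formula and its rescaled form express the integrals of both sides over small sets as
projection norms, which refinability compares. -/
theorem IsSpectralData.le_comp (h : IsSpectralData V φ σ) {A : (Rd d →L[ℝ] Rd d)ˣ}
    (hVA : IsRefinable A V) : ∀ᵐ ξ, σ ξ ≤ σ (powMap (star A) (-1) ξ) := by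
  set T := ((star A)⁻¹).val with hT
  have hpow : ∀ ξ, powMap (star A) (-1) ξ = T ξ := fun ξ => by rw [powMap, zpow_neg_one]
  -- Chosen so that a ball of radius `r` and its image under `T` both lie in balls of radius `1/2`.
  set r : ℝ := 1 / 2 / (1 + ‖T‖) with hr
  have hT0 : 0 < 1 + ‖T‖ := by positivity
  have hr0 : 0 < r := by positivity
  have hr1 : r ≤ 1 / 2 := div_le_self (by norm_num) (by linarith [norm_nonneg T])
  have hr2 : ‖T‖ * r < 1 / 2 := by
    have : (1 + ‖T‖) * r = 1 / 2 := by rw [hr]; field_simp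
    linarith
  have key : (fun ξ => ENNReal.ofReal (σ ξ)) ≤ᵐ[volume] fun ξ => ENNReal.ofReal (σ (T ξ)) := by
    refine ae_le_of_forall_setLIntegral_le_ball h.aemeasurable.ennreal_ofReal hr0
      fun c E hE hc => ?_
    have hE' : volume E ≠ ⊤ := ((measure_mono hc).trans_lt measure_ball_lt_top).ne
    have hc' : (star A).val ⁻¹' E ⊆ Metric.ball (T c) (1 / 2) := by
      intro ξ hξ
      have h1 := hc hξ
      rw [Metric.mem_ball, dist_eq_norm] at h1 ⊢
      have h2 : ξ - T c = T ((star A).val ξ - c) := by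
        rw [map_sub, hT, unit_inv_apply]
      rw [h2]
      calc ‖T ((star A).val ξ - c)‖ ≤ ‖T‖ * ‖(star A).val ξ - c‖ := T.le_opNorm _
        _ ≤ ‖T‖ * r := by gcongr
        _ < 1 / 2 := hr2
    rw [h.lintegral_eq E hE hE' c (hc.trans (Metric.ball_subset_ball hr1)),
      h.lintegral_comp_eq A hE hE' hc']
    refine ENNReal.ofReal_le_ofReal ?_
    have := hVA.norm_starProjection_le (V := V) (fourierIndicator E hE hE')
    gcongr
  have hI : ∀ᵐ ξ, 0 ≤ σ (T ξ) := by
    filter_upwards [(quasiMeasurePreserving (star A)⁻¹).ae h.mem_Icc] with ξ hξ using hξ.1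
  filter_upwards [key, hI] with ξ h1 h2
  rw [hpow]
  exact (ENNReal.ofReal_le_ofReal_iff h2).1 h1

end Monotone

end ShiftInv

end

noncomputable section

namespace ShiftInv

variable {d : ℕ}

/-! ### Functions that increase along the orbits of a contraction -/

/-- A contracting inverse `B⁻¹`, a `B`-invariant set `G` of positive measure, and a function with
values in `[0, 1]` which increases along the orbits of `B⁻¹`. -/
structure IsOrbitMonotone (B : (Rd d →L[ℝ] Rd d)ˣ) (G : Set (Rd d)) (σ : Rd d → ℝ) : Prop where
  tendsto_zero : Tendsto (fun j : ℕ => ((B⁻¹) ^ j).val) atTop (𝓝 0)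
  measurableSet : MeasurableSet G
  image_ae_eq : powMap B 1 '' G =ᵐ[volume] G
  volume_pos : 0 < volume G
  aemeasurable : AEMeasurable σ volume
  mem_Icc : ∀ᵐ ξ, σ ξ ∈ Set.Icc (0 : ℝ) 1
  le_comp : ∀ᵐ ξ, σ ξ ≤ σ (powMap B (-1) ξ)

theorem tendsto_measureReal_zero {X : Type*} [MeasurableSpace X] {μ : Measure X}
    [IsFiniteMeasure μ] {S : ℕ → Set X} (hS : ∀ j, NullMeasurableSet (S j) μ)
    (h : ∀ᵐ x ∂μ, ∀ᶠ j in atTop, x ∉ S j) : Tendsto (fun j => μ.real (S j)) atTop (𝓝 0) := by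
  -- Measurable hulls replace the merely null-measurable `S j`; a.e. convergence of indicators then
  -- gives the limit on a finite measure space.
  have h1 : Tendsto (fun j => μ (toMeasurable μ (S j))) atTop (𝓝 (μ ∅)) := by
    refine tendsto_measure_of_ae_tendsto_indicator_of_isFiniteMeasure atTop MeasurableSet.empty
      (fun j => measurableSet_toMeasurable _ _) ?_
    have h2 : ∀ᵐ x ∂μ, ∀ j, x ∈ toMeasurable μ (S j) ↔ x ∈ S j :=
      ae_all_iff.2 fun j => (hS j).toMeasurable_ae_eq.mem_iff
    filter_upwards [h, h2] with x hx hx2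
    filter_upwards [hx] with j hj
    rw [hx2 j]
    simp [hj]
  simp only [measure_toMeasurable, measure_empty] at h1
  exact (ENNReal.tendsto_toReal ENNReal.zero_ne_top).comp h1

section Orbit

variable {B : (Rd d →L[ℝ] Rd d)ˣ} {G : Set (Rd d)} {σ : Rd d → ℝ}

theorem ae_powMap {p : Rd d → Prop} (B : (Rd d →L[ℝ] Rd d)ˣ) (h : ∀ᵐ ξ, p ξ) :
    ∀ᵐ ξ, ∀ j : ℤ, p (powMap B j ξ) :=
  ae_all_iff.2 fun j => (quasiMeasurePreserving_powMap B j).ae h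

theorem ae_mem_iff_of_image_ae_eq (hG : powMap B 1 '' G =ᵐ[volume] G) :
    ∀ᵐ ξ, ∀ j : ℤ, powMap B j ξ ∈ G ↔ ξ ∈ G := by
  rw [powMap_image] at hG
  filter_upwards [ae_powMap B hG.mem_iff] with ξ hξ j
  have hstep : ∀ j, powMap B (j - 1) ξ ∈ G ↔ powMap B j ξ ∈ G := by
    intro j
    have := hξ j
    rw [Set.mem_preimage, powMap_powMap] at this
    rwa [sub_eq_neg_add]
  induction j using Int.induction_on with
  | zero => rw [powMap_zero]
  | succ n ih => rw [← hstep, add_sub_cancel_right]; exact ih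
  | pred n ih => rw [hstep]; exact ih

theorem eventually_powMap_mem_ball (hB : Tendsto (fun j : ℕ => ((B⁻¹) ^ j).val) atTop (𝓝 0))
    (R : ℝ) {δ : ℝ} (hδ : 0 < δ) :
    ∀ᶠ j : ℕ in atTop, ∀ ξ ∈ Metric.ball (0 : Rd d) R,
      powMap B (-(j : ℤ)) ξ ∈ Metric.ball (0 : Rd d) δ := by
  have h1 : Tendsto (fun j : ℕ => ‖((B⁻¹) ^ j).val‖ * R) atTop (𝓝 0) := by
    simpa using hB.norm.mul_const R
  filter_upwards [h1.eventually (gt_mem_nhds hδ)] with j hj ξ hξ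
  rw [mem_ball_zero_iff] at hξ ⊢
  rw [powMap_neg_natCast]
  refine lt_of_le_of_lt (ContinuousLinearMap.le_opNorm _ _) (lt_of_le_of_lt ?_ hj)
  gcongr

/-- Some positive power of `B⁻¹` maps the unit ball into itself, so it does not increase volume. -/
theorem absDet_zpow_neg_le_one (hB : Tendsto (fun j : ℕ => ((B⁻¹) ^ j).val) atTop (𝓝 0))
    (m : ℕ) : absDet (B ^ (-(m : ℤ))) ≤ 1 := by
  have hpow : ∀ n : ℕ, absDet (B ^ (-(n : ℤ))) = absDet B⁻¹ ^ n := by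
    intro n
    rw [zpow_neg, zpow_natCast, ← inv_pow]
    induction n with
    | zero => rw [pow_zero, pow_zero, absDet_one]
    | succ n ih => rw [pow_succ, absDet_mul, ih, pow_succ]
  obtain ⟨j, hj, hj0⟩ := ((eventually_powMap_mem_ball hB 1 one_pos).and
    (eventually_gt_atTop 0)).exists
  have h1 : volume.real (powMap B (-(j : ℤ)) '' Metric.ball 0 1) ≤
      volume.real (Metric.ball (0 : Rd d) 1) :=
    measureReal_mono (Set.image_subset_iff.2 hj) measure_ball_lt_top.ne
  have hpos : 0 < volume.real (Metric.ball (0 : Rd d) 1) :=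
    ENNReal.toReal_pos (Metric.measure_ball_pos _ _ one_pos).ne' measure_ball_lt_top.ne
  rw [volumeReal_powMap_image] at h1
  have h2 : absDet (B ^ (-(j : ℤ))) ≤ 1 := by
    by_contra hcon
    nlinarith
  rw [hpow] at h2 ⊢
  have h3 : absDet B⁻¹ ≤ 1 := by
    by_contra hcon
    exact absurd h2 (not_le.2 (one_lt_pow₀ (not_le.1 hcon) hj0.ne'))
  exact pow_le_one₀ (absDet_pos _).le h3

theorem setIntegral_powMap_image (B : (Rd d →L[ℝ] Rd d)ˣ) (j : ℤ) {E : Set (Rd d)}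
    (hE : MeasurableSet E) (f : Rd d → ℝ) :
    ∫ ξ in powMap B j '' E, f ξ = absDet (B ^ j) * ∫ ξ in E, f (powMap B j ξ) := by
  have hE2 : MeasurableSet (powMap B j '' E) := by
    rw [powMap_image]
    exact hE.preimage (measurable_powMap B _)
  rw [← integral_indicator hE, ← integral_indicator hE2]
  have h := integral_comp_unit (B ^ j) ((powMap B j '' E).indicator f)
  have h2 : ∀ ξ, (powMap B j '' E).indicator f ((B ^ j).val ξ) =
      E.indicator (fun ξ => f (powMap B j ξ)) ξ := by
    intro ξ
    have hiff : powMap B j ξ ∈ powMap B j '' E ↔ ξ ∈ E := by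
      rw [powMap_image, Set.mem_preimage, powMap_neg_powMap]
    change (powMap B j '' E).indicator f (powMap B j ξ) = _
    by_cases hξ : ξ ∈ E
    · rw [Set.indicator_of_mem (hiff.2 hξ), Set.indicator_of_mem hξ]
    · rw [Set.indicator_of_notMem (fun h => hξ (hiff.1 h)), Set.indicator_of_notMem hξ]
  simp_rw [h2] at h
  rw [h, smul_eq_mul, ← mul_assoc, mul_inv_cancel₀ (absDet_pos _).ne', one_mul]

theorem average_powMap_image (B : (Rd d →L[ℝ] Rd d)ˣ) (j : ℤ) {E : Set (Rd d)}
    (hE : MeasurableSet E) (f : Rd d → ℝ) :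
    1 / volume.real (powMap B j '' E) * ∫ ξ in powMap B j '' E, f ξ =
      1 / volume.real E * ∫ ξ in E, f (powMap B j ξ) := by
  rw [setIntegral_powMap_image B j hE, volumeReal_powMap_image]
  have := (absDet_pos (B ^ j)).ne'
  rw [one_div, one_div, mul_inv, ← mul_assoc, mul_right_comm (absDet (B ^ j))⁻¹,
    inv_mul_cancel₀ this, one_mul]

/-- The measure on `G ∩ B_r`. -/
def localMeasure (G : Set (Rd d)) (r : ℝ) : Measure (Rd d) :=
  volume.restrict (G ∩ Metric.ball 0 r)

instance (G : Set (Rd d)) (r : ℝ) : IsFiniteMeasure (localMeasure G r) :=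
  ⟨by
    rw [localMeasure, Measure.restrict_apply_univ]
    exact (measure_mono Set.inter_subset_right).trans_lt measure_ball_lt_top⟩

theorem localMeasure_absolutelyContinuous (G : Set (Rd d)) (r : ℝ) :
    localMeasure G r ≪ volume := Measure.restrict_le_self.absolutelyContinuous

theorem localMeasure_mono (G : Set (Rd d)) {r s : ℝ} (h : r ≤ s) :
    localMeasure G r ≤ localMeasure G s :=
  Measure.restrict_mono (Set.inter_subset_inter_right _ (Metric.ball_subset_ball h)) le_rfl

namespace IsOrbitMonotone

variable (h : IsOrbitMonotone B G σ)
include h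

theorem ae_monotone : ∀ᵐ ξ, Monotone fun j : ℕ => σ (powMap B (-(j : ℤ)) ξ) := by
  filter_upwards [ae_powMap B h.le_comp] with ξ hξ
  refine monotone_nat_of_le_succ fun j => ?_
  have := hξ (-(j : ℤ))
  rw [powMap_powMap] at this
  rwa [show -((j + 1 : ℕ) : ℤ) = -1 + -(j : ℤ) by push_cast; ring]

theorem ae_mem_Icc : ∀ᵐ ξ, ∀ j : ℤ, σ (powMap B j ξ) ∈ Set.Icc (0 : ℝ) 1 := ae_powMap B h.mem_Icc

theorem aemeasurable_comp (j : ℤ) : AEMeasurable (fun ξ => σ (powMap B j ξ)) volume :=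
  h.aemeasurable.comp_quasiMeasurePreserving (quasiMeasurePreserving_powMap B j)

theorem measurableSet_inter_ball (r : ℝ) : MeasurableSet (G ∩ Metric.ball 0 r) :=
  h.measurableSet.inter measurableSet_ball

/-- Every orbit of `B⁻¹` enters the ball and `G` is invariant, so if `G` were null near the origin
it would be null. -/
theorem volume_inter_ball_pos {r : ℝ} (hr : 0 < r) : 0 < volume (G ∩ Metric.ball 0 r) := by
  rw [pos_iff_ne_zero]
  intro h0
  have h1 : ∀ᵐ ξ : Rd d, ξ ∉ G ∩ Metric.ball 0 r := measure_eq_zero_iff_ae_notMem.1 h0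
  refine h.volume_pos.ne' (measure_eq_zero_iff_ae_notMem.2 ?_)
  filter_upwards [ae_powMap B h1, ae_mem_iff_of_image_ae_eq h.image_ae_eq] with ξ a b hξ
  obtain ⟨j, hj⟩ := (eventually_powMap_mem_ball h.tendsto_zero (‖ξ‖ + 1) hr).exists
  exact a (-(j : ℤ)) ⟨(b _).2 hξ, hj ξ (by rw [mem_ball_zero_iff]; linarith)⟩

theorem volumeReal_inter_ball_pos {r : ℝ} (hr : 0 < r) :
    0 < volume.real (G ∩ Metric.ball 0 r) :=
  ENNReal.toReal_pos (h.volume_inter_ball_pos hr).ne'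
    ((measure_mono Set.inter_subset_right).trans_lt measure_ball_lt_top).ne

/-- Blowing up by `B ^ j` replaces shrinking balls by the fixed set `G ∩ B_r`. The determinant
factor cancels in every density quotient. -/
theorem volumeReal_inter_shrunkBall (T : Set (Rd d)) (j : ℕ) (r : ℝ) :
    volume.real (T ∩ G ∩ shrunkBall B j r) = absDet (B ^ (-(j : ℤ))) *
      (localMeasure G r).real {ξ | powMap B (-(j : ℤ)) ξ ∈ T} := by
  have h1 : T ∩ G ∩ shrunkBall B j r = powMap B (-(j : ℤ)) ''
      (powMap B (-(j : ℤ)) ⁻¹' (T ∩ G) ∩ Metric.ball 0 r) := by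
    rw [Set.image_preimage_inter]
    rfl
  rw [h1, volumeReal_powMap_image, localMeasure,
    measureReal_restrict_apply' (h.measurableSet_inter_ball r)]
  congr 1
  refine measureReal_congr ?_
  filter_upwards [ae_mem_iff_of_image_ae_eq h.image_ae_eq] with ξ hξ
  have h2 := hξ (-(j : ℤ))
  refine propext ⟨?_, ?_⟩
  · rintro ⟨⟨a, b⟩, c⟩
    exact ⟨a, h2.1 b, c⟩
  · rintro ⟨a, b, c⟩
    exact ⟨⟨a, h2.2 b⟩, c⟩

theorem ratio_eq (T : Set (Rd d)) (j : ℕ) (r : ℝ) :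
    volume.real (T ∩ G ∩ shrunkBall B j r) / volume.real (G ∩ shrunkBall B j r) =
      (localMeasure G r).real {ξ | powMap B (-(j : ℤ)) ξ ∈ T} /
        volume.real (G ∩ Metric.ball 0 r) := by
  have h1 := h.volumeReal_inter_shrunkBall Set.univ j r
  rw [Set.univ_inter] at h1
  have h2 : {ξ | powMap B (-(j : ℤ)) ξ ∈ (Set.univ : Set (Rd d))} = Set.univ := by
    ext
    simp
  rw [h2, localMeasure, measureReal_restrict_apply' (h.measurableSet_inter_ball r),
    Set.univ_inter] at h1
  rw [h.volumeReal_inter_shrunkBall, h1, mul_div_mul_left _ _ (absDet_pos _).ne']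

theorem isLocallyNonzero_iff : IsLocallyNonzero G B σ ↔ Tendsto
    (fun j : ℕ => (localMeasure G 1).real {ξ | σ (powMap B (-(j : ℤ)) ξ) = 0}) atTop (𝓝 0) := by
  have hpos := h.volumeReal_inter_ball_pos one_pos
  have h1 : ∀ j : ℕ, volume.real {x | x ∈ G ∩ shrunkBall B j 1 ∧ σ x = 0} /
      volume.real (G ∩ shrunkBall B j 1) =
      (localMeasure G 1).real {ξ | σ (powMap B (-(j : ℤ)) ξ) = 0} /
        volume.real (G ∩ Metric.ball 0 1) := by
    intro j
    refine Eq.trans ?_ (h.ratio_eq {x | σ x = 0} j 1)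
    congr 2
    ext x
    simp only [Set.mem_inter_iff, Set.mem_ofPred_eq]
    tauto
  rw [IsLocallyNonzero]
  simp_rw [h1]
  constructor
  · intro hlim
    have := hlim.mul_const (volume.real (G ∩ Metric.ball 0 1))
    simpa only [div_mul_cancel₀ _ hpos.ne', zero_mul] using this
  · intro hlim
    simpa using hlim.div_const (volume.real (G ∩ Metric.ball 0 1))

theorem ae_localMeasure {p : Rd d → Prop} (hp : ∀ᵐ ξ : Rd d, ξ ∈ G → p ξ) (r : ℝ) :
    ∀ᵐ ξ ∂(localMeasure G r), p ξ := by
  rw [localMeasure, ae_restrict_iff' (h.measurableSet_inter_ball r)]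
  filter_upwards [hp] with ξ hξ hm using hξ hm.1

/-- A property that holds along the whole orbit as soon as it holds at one of its points need only
be checked near the origin. -/
theorem ae_of_ae_localMeasure {p : Rd d → Prop} {r : ℝ} (hr : 0 < r)
    (hp : ∀ᵐ ξ ∂(localMeasure G r), p ξ)
    (horb : ∀ (ξ : Rd d) (m : ℕ), p (powMap B (-(m : ℤ)) ξ) → p ξ) :
    ∀ᵐ ξ : Rd d, ξ ∈ G → p ξ := by
  rw [localMeasure, ae_restrict_iff' (h.measurableSet_inter_ball r)] at hp
  filter_upwards [ae_powMap B hp, ae_mem_iff_of_image_ae_eq h.image_ae_eq] with ξ a b hξ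
  obtain ⟨j, hj⟩ := (eventually_powMap_mem_ball h.tendsto_zero (‖ξ‖ + 1) hr).exists
  exact horb ξ j (a _ ⟨(b _).2 hξ, hj ξ (by rw [mem_ball_zero_iff]; linarith)⟩)

/-- Almost every point of `G ∩ B_1` eventually leaves the zero sets of `σ(B⁻ʲ·)`, so their measures
tend to zero. -/
theorem isLocallyNonzero_of_isAbsorbing (habs : IsAbsorbing B⁻¹ (Function.support σ) G) :
    IsLocallyNonzero G B σ := by
  rw [h.isLocallyNonzero_iff]
  refine tendsto_measureReal_zero (fun j => ?_) ?_
  · exact ((h.aemeasurable_comp _).nullMeasurableSet_preimage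
      (measurableSet_singleton 0)).mono_ac (localMeasure_absolutelyContinuous G 1)
  · filter_upwards [h.ae_localMeasure habs 1] with ξ hξ
    obtain ⟨j₀, -, hj⟩ := hξ
    filter_upwards [eventually_ge_atTop j₀] with j hj'
    have := hj j hj'
    rwa [powMap_inv] at this

/-- The common zero set of all `σ(B⁻ʲ·)` in `G ∩ B_1` is null. Off it some value is positive, and by
monotonicity so are all later ones. -/
theorem isAbsorbing_of_isLocallyNonzero (hloc : IsLocallyNonzero G B σ) :
    IsAbsorbing B⁻¹ (Function.support σ) G := by
  rw [h.isLocallyNonzero_iff] at hloc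
  refine h.ae_of_ae_localMeasure one_pos ?_ ?_
  · have hac := localMeasure_absolutelyContinuous G 1
    have hnull : (localMeasure G 1) (⋂ j : ℕ, {ξ | σ (powMap B (-(j : ℤ)) ξ) = 0}) = 0 := by
      rw [← measureReal_eq_zero_iff]
      refine le_antisymm (ge_of_tendsto' hloc fun j => ?_) measureReal_nonneg
      exact measureReal_mono (Set.iInter_subset _ j)
    filter_upwards [measure_eq_zero_iff_ae_notMem.1 hnull, hac h.ae_monotone, hac h.ae_mem_Icc]
      with ξ h1 h2 h3
    rw [Set.mem_iInter, not_forall] at h1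
    obtain ⟨j₀, hj₀⟩ := h1
    have hpos : 0 < σ (powMap B (-(j₀ : ℤ)) ξ) := lt_of_le_of_ne (h3 _).1 (Ne.symm hj₀)
    refine ⟨j₀ + 1, Nat.succ_pos _, fun j hj => ?_⟩
    rw [powMap_inv]
    exact (hpos.trans_le (h2 (by lia : j₀ ≤ j))).ne'
  · rintro ξ m ⟨j₀, hj₀, hj⟩
    refine ⟨j₀ + m, by lia, fun j hjm => ?_⟩
    have := hj (j - m) (by lia)
    rw [powMap_inv, powMap_powMap] at this
    rw [powMap_inv]
    convert this using 2
    push_cast [Nat.cast_sub (by lia : m ≤ j)]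
    ring

/-- The single set `E = G ∩ B_1` suffices. The monotone limit `s` satisfies `s ≤ 1`, and dominated
convergence shows that its average there is `1`, so `s = 1` a.e. -/
theorem tendsto_one_of_average (hav : ∀ E : Set (Rd d), E ⊆ G → MeasurableSet E →
      Bornology.IsBounded E → 0 < volume E → Tendsto (fun j : ℕ =>
        1 / volume.real (powMap B (-(j : ℤ)) '' E) * ∫ ξ in powMap B (-(j : ℤ)) '' E, σ ξ)
        atTop (𝓝 1)) :
    ∀ᵐ ξ : Rd d, ξ ∈ G → Tendsto (fun j : ℕ => σ (powMap B (-(j : ℤ)) ξ)) atTop (𝓝 1) := by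
  refine h.ae_of_ae_localMeasure one_pos ?_ ?_
  · have hac := localMeasure_absolutelyContinuous G 1
    have hav1 := hav (G ∩ Metric.ball 0 1) Set.inter_subset_left (h.measurableSet_inter_ball 1)
      (Metric.isBounded_ball.subset Set.inter_subset_right) (h.volume_inter_ball_pos one_pos)
    simp_rw [average_powMap_image B _ (h.measurableSet_inter_ball 1)] at hav1
    set s : Rd d → ℝ := fun ξ => ⨆ j : ℕ, σ (powMap B (-(j : ℤ)) ξ) with hs
    have hbdd : ∀ᵐ ξ, BddAbove (Set.range fun j : ℕ => σ (powMap B (-(j : ℤ)) ξ)) := by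
      filter_upwards [h.ae_mem_Icc] with ξ hξ
      exact ⟨1, by rintro _ ⟨j, rfl⟩; exact (hξ _).2⟩
    have hlim : ∀ᵐ ξ, Tendsto (fun j : ℕ => σ (powMap B (-(j : ℤ)) ξ)) atTop (𝓝 (s ξ)) := by
      filter_upwards [h.ae_monotone, hbdd] with ξ h1 h2
      exact tendsto_atTop_ciSup h1 h2
    have hs1 : ∀ᵐ ξ, s ξ ≤ 1 := by
      filter_upwards [h.ae_mem_Icc] with ξ hξ
      exact ciSup_le fun j => (hξ _).2
    have hs0 : ∀ᵐ ξ, 0 ≤ s ξ := by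
      filter_upwards [h.ae_mem_Icc] with ξ hξ
      exact Real.iSup_nonneg fun j => (hξ _).1
    have hmeas : ∀ j : ℕ, AEStronglyMeasurable (fun ξ => σ (powMap B (-(j : ℤ)) ξ))
        (localMeasure G 1) := fun j =>
      ((h.aemeasurable_comp _).mono_ac hac).aestronglyMeasurable
    have hint := tendsto_integral_of_dominated_convergence (μ := localMeasure G 1)
      (fun _ => (1 : ℝ)) hmeas (integrable_const _) (fun j => by
        filter_upwards [hac h.ae_mem_Icc] with ξ hξ
        rw [Real.norm_eq_abs, abs_of_nonneg (hξ _).1]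
        exact (hξ _).2) (hac hlim)
    have hsm : AEStronglyMeasurable s (localMeasure G 1) :=
      aestronglyMeasurable_of_tendsto_ae atTop hmeas (hac hlim)
    have hsi : Integrable s (localMeasure G 1) := by
      refine Integrable.of_bound hsm 1 ?_
      filter_upwards [hac hs0, hac hs1] with ξ a b
      rwa [Real.norm_eq_abs, abs_of_nonneg a]
    have hpos := h.volumeReal_inter_ball_pos one_pos
    have heq : ∫ ξ, s ξ ∂(localMeasure G 1) = volume.real (G ∩ Metric.ball 0 1) := by
      have h1 := tendsto_nhds_unique hav1 (hint.const_mul (1 / volume.real (G ∩ Metric.ball 0 1)))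
      field_simp at h1
      exact h1.symm
    have hz : ∫ ξ, (1 - s ξ) ∂(localMeasure G 1) = 0 := by
      rw [integral_sub (integrable_const _) hsi, heq, integral_const, localMeasure,
        measureReal_restrict_apply' (h.measurableSet_inter_ball 1), Set.univ_inter]
      simp
    have hz' := (integral_eq_zero_iff_of_nonneg_ae (by
      filter_upwards [hac hs1] with ξ hξ using sub_nonneg.2 hξ) ((integrable_const _).sub hsi)).1 hz
    filter_upwards [hz', hac hlim] with ξ h1 h2
    have : s ξ = 1 := (sub_eq_zero.1 h1).symm
    rwa [this] at h2
  · intro ξ m hm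
    refine (tendsto_add_atTop_iff_nat m).1 (hm.congr fun j => ?_)
    rw [powMap_powMap]
    congr 2
    push_cast
    ring

end IsOrbitMonotone

end Orbit

end ShiftInv

end

noncomputable section

namespace ShiftInv

variable {d : ℕ} {B : (Rd d →L[ℝ] Rd d)ˣ} {G : Set (Rd d)} {σ : Rd d → ℝ}

/-! ### Approximate continuity at the origin -/

theorem isOpen_shrunkBall (B : (Rd d →L[ℝ] Rd d)ˣ) (j : ℕ) (r : ℝ) :
    IsOpen (shrunkBall B j r) := by
  rw [shrunkBall, powMap_image]
  exact Metric.isOpen_ball.preimage (B ^ (- -(j : ℤ))).val.continuous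

theorem zero_mem_shrunkBall (B : (Rd d →L[ℝ] Rd d)ˣ) (j : ℕ) {r : ℝ} (hr : 0 < r) :
    (0 : Rd d) ∈ shrunkBall B j r :=
  ⟨0, Metric.mem_ball_self hr, map_zero (B ^ (-(j : ℤ))).val⟩

namespace IsOrbitMonotone

variable (h : IsOrbitMonotone B G σ)
include h

theorem localMeasure_real_univ (r : ℝ) :
    (localMeasure G r).real Set.univ = volume.real (G ∩ Metric.ball 0 r) := by
  rw [localMeasure, measureReal_restrict_apply' (h.measurableSet_inter_ball r), Set.univ_inter]

/-- `E` has density one at the origin as soon as its complement has density zero. -/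
theorem isDensityPoint_of_tendsto {E : Set (Rd d)} (hE : MeasurableSet E)
    (hlim : ∀ r : ℝ, 0 < r → Tendsto
      (fun j : ℕ => (localMeasure G r).real {ξ | powMap B (-(j : ℤ)) ξ ∉ E}) atTop (𝓝 0)) :
    IsDensityPoint G B E := by
  intro r hr
  have hpos := h.volumeReal_inter_ball_pos hr
  simp_rw [h.ratio_eq]
  have h1 : ∀ j : ℕ, (localMeasure G r).real {ξ | powMap B (-(j : ℤ)) ξ ∈ E} =
      volume.real (G ∩ Metric.ball 0 r) -
        (localMeasure G r).real {ξ | powMap B (-(j : ℤ)) ξ ∉ E} := by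
    intro j
    have hm : MeasurableSet {ξ | powMap B (-(j : ℤ)) ξ ∈ E} := hE.preimage (measurable_powMap B _)
    rw [← h.localMeasure_real_univ, eq_sub_iff_add_eq]
    exact measureReal_add_measureReal_compl hm
  have h2 := ((tendsto_const_nhds (x := volume.real (G ∩ Metric.ball 0 r))).sub
    (hlim r hr)).div_const (volume.real (G ∩ Metric.ball 0 r))
  rw [sub_zero, div_self hpos.ne'] at h2
  exact h2.congr fun j => by rw [h1]

theorem tendsto_localMeasure_compl_of_isDensityPoint {E : Set (Rd d)} (hE : MeasurableSet E)
    (hd : IsDensityPoint G B E) {r : ℝ} (hr : 0 < r) : Tendsto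
      (fun j : ℕ => (localMeasure G r).real {ξ | powMap B (-(j : ℤ)) ξ ∉ E}) atTop (𝓝 0) := by
  have hpos := h.volumeReal_inter_ball_pos hr
  have hlim := hd r hr
  simp_rw [h.ratio_eq] at hlim
  have h2 := (tendsto_const_nhds (x := volume.real (G ∩ Metric.ball 0 r))).sub
    (hlim.mul_const (volume.real (G ∩ Metric.ball 0 r)))
  rw [one_mul, sub_self] at h2
  refine h2.congr fun j => ?_
  have hm : MeasurableSet {ξ | powMap B (-(j : ℤ)) ξ ∈ E} := hE.preimage (measurable_powMap B _)
  rw [div_mul_cancel₀ _ hpos.ne', ← h.localMeasure_real_univ, sub_eq_iff_eq_add']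
  exact (measureReal_add_measureReal_compl hm).symm

/-- Near the origin `σ` can vanish only off `E`, whose complement has density zero. The hypothesis
`h0` handles the altered value at the origin, which is not negligible when `d = 0`. -/
theorem isLocallyNonzero_of_isApproxContinuous (h0 : σ 0 ≠ 0 ∨ volume {(0 : Rd d)} = 0)
    (hac : IsApproxContinuous G B (Function.update σ 0 1)) : IsLocallyNonzero G B σ := by
  obtain ⟨E, hE, -, hd, hlim⟩ := hac
  rw [Function.update_self] at hlim
  rw [h.isLocallyNonzero_iff]
  have hev : ∀ᶠ x in 𝓝[E] (0 : Rd d), Function.update σ 0 1 x ≠ 0 :=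
    hlim.eventually_ne one_ne_zero
  rw [eventually_nhdsWithin_iff, Metric.eventually_nhds_iff_ball] at hev
  obtain ⟨δ, hδ, hev⟩ := hev
  refine tendsto_of_tendsto_of_tendsto_of_le_of_le' tendsto_const_nhds
    (h.tendsto_localMeasure_compl_of_isDensityPoint hE hd one_pos)
    (Eventually.of_forall fun j => measureReal_nonneg) ?_
  have hzero : ∀ᵐ x : Rd d, x = 0 → σ x ≠ 0 := by
    rcases h0 with h0 | h0
    · exact Eventually.of_forall fun x hx => hx ▸ h0
    · filter_upwards [measure_eq_zero_iff_ae_notMem.1 h0] with x hx hx0 using absurd hx0 hx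
  filter_upwards [eventually_powMap_mem_ball h.tendsto_zero 1 hδ] with j hj
  refine ENNReal.toReal_mono (measure_ne_top _ _) (measure_mono_ae ?_)
  have hball : ∀ᵐ ξ ∂(localMeasure G 1), ξ ∈ G ∩ Metric.ball 0 1 :=
    ae_restrict_mem (h.measurableSet_inter_ball 1)
  filter_upwards [localMeasure_absolutelyContinuous G 1 (ae_powMap B hzero), hball]
    with ξ h1 h2 h3 h4
  have h5 := hev _ (hj ξ h2.2) h4
  by_cases hx : powMap B (-(j : ℤ)) ξ = 0
  · exact h1 _ hx h3
  · rw [Function.update_of_ne hx] at h5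
    exact h5 h3

/-- Convergence a.e. implies convergence in measure; the measurable representative `τ` makes the
level sets measurable. -/
theorem tendsto_localMeasure_le (hlim : ∀ᵐ ξ : Rd d, ξ ∈ G →
      Tendsto (fun j : ℕ => σ (powMap B (-(j : ℤ)) ξ)) atTop (𝓝 1)) {τ : Rd d → ℝ}
    (hτ : Measurable τ) (hστ : σ =ᵐ[volume] τ) {ε : ℝ} (hε : 0 < ε) (r : ℝ) :
    Tendsto (fun j : ℕ => (localMeasure G r).real {ξ | τ (powMap B (-(j : ℤ)) ξ) ≤ 1 - ε})
      atTop (𝓝 0) := by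
  refine tendsto_measureReal_zero (fun j => MeasurableSet.nullMeasurableSet
    (measurableSet_le (hτ.comp (measurable_powMap B _)) measurable_const)) ?_
  filter_upwards [h.ae_localMeasure hlim r,
    localMeasure_absolutelyContinuous G r (ae_powMap B hστ)] with ξ h1 h2
  filter_upwards [h1.eventually (lt_mem_nhds (by linarith : 1 - ε < 1))] with j hj
  exact not_le.2 ((h2 (-(j : ℤ))) ▸ hj)

/-- `E` is obtained by deleting, for every `n`, the points of the `n`-th neighbourhood of `0` at
which the function is at most `1 - ε n`. The neighbourhoods shrink fast enough for the rescaled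
deleted sets to be dominated by a geometric series, uniformly in the scale `j`; each tends to zero
as `j → ∞`, so `E` has density one. -/
theorem isApproxContinuous (hlim : ∀ᵐ ξ : Rd d, ξ ∈ G →
      Tendsto (fun j : ℕ => σ (powMap B (-(j : ℤ)) ξ)) atTop (𝓝 1)) :
    IsApproxContinuous G B (Function.update σ 0 1) := by
  obtain ⟨τ, hτ, hστ⟩ := h.aemeasurable
  set ε : ℕ → ℝ := fun n => 1 / ((n : ℝ) + 1) with hε
  have hε0 : ∀ n, 0 < ε n := fun n => Nat.one_div_pos_of_nat
  have hchoose : ∀ n : ℕ, ∃ N : ℕ, ∀ j ≥ N,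
      (localMeasure G (n + 1)).real {ξ | τ (powMap B (-(j : ℤ)) ξ) ≤ 1 - ε n} ≤ (1 / 2) ^ n :=
    fun n => eventually_atTop.1 ((h.tendsto_localMeasure_le hlim hτ hστ (hε0 n) (n + 1)).eventually
      (ge_mem_nhds (by positivity)))
  choose N hN using hchoose
  set bad : ℕ → Set (Rd d) := fun n => shrunkBall B (N n) (n + 1) ∩ {x | τ x ≤ 1 - ε n} with hbad
  have hbadm : ∀ n, MeasurableSet (bad n) := fun n =>
    (isOpen_shrunkBall B _ _).measurableSet.inter (measurableSet_le hτ measurable_const)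
  -- Removing this null set as well turns the a.e. facts on `σ` into pointwise facts on `E`.
  set M : Set (Rd d) := toMeasurable volume {x | ¬ (σ x = τ x ∧ σ x ≤ 1)} with hM
  have hMnull : volume M = 0 := by
    rw [hM, measure_toMeasurable]
    change ∀ᵐ x, σ x = τ x ∧ σ x ≤ 1
    filter_upwards [hστ, h.mem_Icc] with x a b using ⟨a, b.2⟩
  have hMsub : ∀ x, x ∉ M → σ x = τ x ∧ σ x ≤ 1 := by
    intro x hx
    by_contra hcon
    exact hx (subset_toMeasurable _ _ hcon)
  set E : Set (Rd d) := (M ∪ ⋃ n, bad n)ᶜ with hE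
  have hEm : MeasurableSet E :=
    ((measurableSet_toMeasurable _ _).union (MeasurableSet.iUnion hbadm)).compl
  have hbound : ∀ (r : ℝ) (n : ℕ) (j : ℕ), r ≤ n + 1 →
      (localMeasure G r).real {ξ | powMap B (-(j : ℤ)) ξ ∈ bad n} ≤ (1 / 2) ^ n := by
    intro r n j hr
    rcases le_or_gt (N n) j with hj | hj
    · refine le_trans ?_ (hN n j hj)
      refine ENNReal.toReal_mono (measure_ne_top _ _)
        ((localMeasure_mono G hr _).trans (measure_mono ?_))
      exact fun ξ hξ => hξ.2
    -- At a coarser scale `j < N n` the bad set still lies in `B^{-N n} B_{n+1}`. Its rescaled copy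
    -- is the `B^{-m}`-image of the one at scale `N n`, and `B^{-m}` does not increase volume.
    · refine le_trans ?_ (hN n (N n) le_rfl)
      set S := {ξ | τ (powMap B (-(N n : ℤ)) ξ) ≤ 1 - ε n} with hS
      set m : ℕ := N n - j with hm
      have hm' : (m : ℤ) = N n - j := by lia
      have h1 : (localMeasure G r).real {ξ | powMap B (-(j : ℤ)) ξ ∈ bad n} ≤
          volume.real (powMap B (-(m : ℤ)) '' (S ∩ (G ∩ Metric.ball 0 (n + 1)))) := by
        rw [localMeasure, measureReal_restrict_apply' (h.measurableSet_inter_ball r)]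
        refine ENNReal.toReal_mono ?_ (measure_mono_ae ?_)
        · rw [volume_powMap_image]
          refine ENNReal.mul_ne_top ENNReal.ofReal_ne_top (ne_top_of_le_ne_top ?_
            (measure_mono (Set.inter_subset_right.trans Set.inter_subset_right)))
          exact measure_ball_lt_top.ne
        filter_upwards [ae_mem_iff_of_image_ae_eq h.image_ae_eq] with ξ hξ
        rintro ⟨⟨⟨η, hη, hηξ⟩, h2⟩, h3, -⟩
        have h4 : η = powMap B m ξ := by
          have := congrArg (powMap B (N n)) hηξ
          rw [powMap_powMap_neg, powMap_powMap] at this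
          rw [this, hm']
          rfl
        refine ⟨η, ⟨?_, ?_, hη⟩, ?_⟩
        · change τ (powMap B (-(N n : ℤ)) η) ≤ 1 - ε n
          rw [hηξ]
          exact h2
        · rw [h4]
          exact (hξ _).2 h3
        · rw [h4, powMap_neg_powMap]
      refine h1.trans ?_
      rw [volumeReal_powMap_image, localMeasure,
        measureReal_restrict_apply' (h.measurableSet_inter_ball _)]
      exact mul_le_of_le_one_left measureReal_nonneg (absDet_zpow_neg_le_one h.tendsto_zero m)
  have hdens : IsDensityPoint G B E := by
    refine h.isDensityPoint_of_tendsto hEm fun r hr => ?_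
    set μ := localMeasure G r with hμ
    -- The second summand absorbs the finitely many `n < ⌈r⌉₊`, for which `hbound` may fail.
    set K : ℝ := 1 + μ.real Set.univ * 2 ^ ⌈r⌉₊ with hK
    have hsum : Summable fun n : ℕ => K * (1 / 2 : ℝ) ^ n :=
      (summable_geometric_of_lt_one (by norm_num) (by norm_num)).mul_left K
    have hμ0 : 0 ≤ μ.real Set.univ := measureReal_nonneg
    have hdom : ∀ (j n : ℕ), μ.real {ξ | powMap B (-(j : ℤ)) ξ ∈ bad n} ≤ K * (1 / 2 : ℝ) ^ n := by
      intro j n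
      rcases le_or_gt ⌈r⌉₊ n with hn | hn
      · have hrn : r ≤ n + 1 := by
          have := Nat.ceil_le.1 hn
          linarith
        refine (hbound r n j hrn).trans (le_mul_of_one_le_left (by positivity) ?_)
        rw [hK]
        have : 0 ≤ μ.real Set.univ * 2 ^ ⌈r⌉₊ := by positivity
        linarith
      · have h1 : (1 : ℝ) ≤ 2 ^ ⌈r⌉₊ * (1 / 2) ^ n := by
          calc (1 : ℝ) = 2 ^ n * (1 / 2) ^ n := by rw [← mul_pow]; norm_num
            _ ≤ 2 ^ ⌈r⌉₊ * (1 / 2) ^ n := by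
              have : (2 : ℝ) ^ n ≤ 2 ^ ⌈r⌉₊ := pow_le_pow_right₀ (by norm_num) hn.le
              gcongr
        calc μ.real {ξ | powMap B (-(j : ℤ)) ξ ∈ bad n} ≤ μ.real Set.univ :=
              measureReal_mono (Set.subset_univ _)
          _ ≤ μ.real Set.univ * (2 ^ ⌈r⌉₊ * (1 / 2) ^ n) := le_mul_of_one_le_right hμ0 h1
          _ ≤ K * (1 / 2) ^ n := by
            rw [hK, ← mul_assoc]
            have : (0 : ℝ) ≤ (1 / 2) ^ n := by positivity
            nlinarith
    have htend : Tendsto (fun j : ℕ => ∑' n, μ.real {ξ | powMap B (-(j : ℤ)) ξ ∈ bad n}) atTop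
        (𝓝 (∑' _ : ℕ, (0 : ℝ))) := by
      refine tendsto_tsum_of_dominated_convergence hsum (fun n => ?_)
        (Eventually.of_forall fun j n => by
          rw [Real.norm_of_nonneg measureReal_nonneg]
          exact hdom j n)
      refine squeeze_zero (fun j => measureReal_nonneg) (fun j => ?_)
        (h.tendsto_localMeasure_le hlim hτ hστ (hε0 n) r)
      exact measureReal_mono fun ξ hξ => hξ.2
    rw [tsum_zero] at htend
    refine squeeze_zero (fun j => measureReal_nonneg) (fun j => ?_) htend
    have hs : Summable fun n => μ.real {ξ | powMap B (-(j : ℤ)) ξ ∈ bad n} :=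
      Summable.of_nonneg_of_le (fun n => measureReal_nonneg) (hdom j) hsum
    have hle : μ {ξ | powMap B (-(j : ℤ)) ξ ∉ E} ≤
        ∑' n, μ {ξ | powMap B (-(j : ℤ)) ξ ∈ bad n} := by
      refine le_trans (measure_mono_ae ?_) (measure_iUnion_le _)
      filter_upwards [localMeasure_absolutelyContinuous G r
        (ae_powMap B (measure_eq_zero_iff_ae_notMem.1 hMnull))] with ξ h1 h2
      have h3 : powMap B (-(j : ℤ)) ξ ∈ M ∪ ⋃ n, bad n := not_not.1 h2
      obtain ⟨n, hn⟩ := Set.mem_iUnion.1 (h3.resolve_left (h1 _))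
      exact Set.mem_iUnion.2 ⟨n, hn⟩
    have heq : ∑' n, μ {ξ | powMap B (-(j : ℤ)) ξ ∈ bad n} =
        ENNReal.ofReal (∑' n, μ.real {ξ | powMap B (-(j : ℤ)) ξ ∈ bad n}) := by
      rw [ENNReal.ofReal_tsum_of_nonneg (fun n => measureReal_nonneg) hs]
      exact tsum_congr fun n => (ENNReal.ofReal_toReal (measure_ne_top _ _)).symm
    rw [heq] at hle
    exact ENNReal.toReal_le_of_le_ofReal (tsum_nonneg fun n => measureReal_nonneg) hle
  refine ⟨E, hEm, ?_, hdens, ?_⟩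
  · rw [pos_iff_ne_zero]
    intro hE0
    obtain ⟨j, hj⟩ := ((hdens 1 one_pos).eventually (lt_mem_nhds one_pos)).exists
    have : volume.real (E ∩ G ∩ shrunkBall B j 1) = 0 := by
      rw [Measure.real, measure_mono_null (Set.inter_subset_left.trans Set.inter_subset_left) hE0,
        ENNReal.toReal_zero]
    rw [this, zero_div] at hj
    exact lt_irrefl _ hj
  · rw [Function.update_self, Metric.tendsto_nhds]
    intro δ hδ
    obtain ⟨n, hn⟩ := exists_nat_one_div_lt hδ
    rw [eventually_nhdsWithin_iff]
    filter_upwards [(isOpen_shrunkBall B (N n) (n + 1)).mem_nhds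
      (zero_mem_shrunkBall B (N n) (by positivity))] with x hx hxE
    by_cases hx0 : x = 0
    · rw [hx0, Function.update_self, dist_self]
      exact hδ
    rw [Function.update_of_ne hx0]
    have hxM : x ∉ M := fun hM => hxE (Or.inl hM)
    obtain ⟨h1, h2⟩ := hMsub x hxM
    have h3 : 1 - ε n < τ x := by
      by_contra hcon
      exact hxE (Or.inr (Set.mem_iUnion.2 ⟨n, hx, not_lt.1 hcon⟩))
    rw [Real.dist_eq, abs_lt]
    have h4 : ε n < δ := hn
    constructor <;> linarith

end IsOrbitMonotone

end ShiftInv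

end

noncomputable section

namespace ShiftInv

variable {d : ℕ}

/-! ### Hardy spaces -/

/-- `H²_G` as a subspace. -/
def hardySubmodule (G : Set (Rd d)) : Submodule ℂ (L2 d) where
  carrier := hardySpace G
  zero_mem' := by
    have h0 : (𝓕 (0 : L2 d) : L2 d) = 0 := map_zero (Lp.fourierTransformₗᵢ (Rd d) ℂ)
    change ∀ᵐ ξ : Rd d, ξ ∉ G → (𝓕 (0 : L2 d) : L2 d) ξ = 0
    rw [h0]
    filter_upwards [Lp.coeFn_zero ℂ 2 (volume : Measure (Rd d))] with ξ hξ _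
    rw [hξ, Pi.zero_apply]
  add_mem' := by
    intro f g hf hg
    have h0 : (𝓕 (f + g) : L2 d) = 𝓕 f + 𝓕 g := map_add (Lp.fourierTransformₗᵢ (Rd d) ℂ) f g
    change ∀ᵐ ξ : Rd d, ξ ∉ G → (𝓕 (f + g) : L2 d) ξ = 0
    rw [h0]
    filter_upwards [hf, hg, Lp.coeFn_add (𝓕 f : L2 d) (𝓕 g)] with ξ h1 h2 h3 hξ
    rw [h3, Pi.add_apply, h1 hξ, h2 hξ, add_zero]
  smul_mem' := by
    intro c f hf
    have h0 : (𝓕 (c • f) : L2 d) = c • 𝓕 f := map_smul (Lp.fourierTransformₗᵢ (Rd d) ℂ) c f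
    change ∀ᵐ ξ : Rd d, ξ ∉ G → (𝓕 (c • f) : L2 d) ξ = 0
    rw [h0]
    filter_upwards [hf, Lp.coeFn_smul c (𝓕 f : L2 d)] with ξ h1 h2 hξ
    rw [h2, Pi.smul_apply, h1 hξ, smul_zero]

/-- It is the kernel of the Fourier transform followed by restriction to the complement of `G`. -/
theorem isClosed_hardySpace {G : Set (Rd d)} (hG : MeasurableSet G) :
    IsClosed (hardySpace G) := by
  set R := LpToLpRestrictCLM (Rd d) ℂ ℂ (volume : Measure (Rd d)) 2 Gᶜ
  have h : hardySpace G = (fun f : L2 d => R (𝓕 f)) ⁻¹' {0} := by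
    ext f
    have h1 : f ∈ hardySpace G ↔
        ((𝓕 f : L2 d) : Rd d → ℂ) =ᵐ[volume.restrict Gᶜ] fun _ => 0 :=
      (ae_restrict_iff' hG.compl).symm
    have h2 : R (𝓕 f) =ᵐ[volume.restrict Gᶜ] ((𝓕 f : L2 d) : Rd d → ℂ) :=
      LpToLpRestrictCLM_coeFn ℂ Gᶜ (𝓕 f : L2 d)
    rw [h1, Set.mem_preimage, Set.mem_singleton_iff, Lp.eq_zero_iff_ae_eq_zero]
    exact ⟨fun h => h2.trans h, fun h => h2.symm.trans h⟩
  rw [h]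
  exact isClosed_singleton.preimage
    (R.continuous.comp (Lp.fourierTransformₗᵢ (Rd d) ℂ).continuous)

theorem fourierIndicator_mem_hardySpace_iff {E G : Set (Rd d)} (hE : MeasurableSet E)
    (hE' : volume E ≠ ⊤) : fourierIndicator E hE hE' ∈ hardySpace G ↔ E ≤ᵐ[volume] G := by
  rw [hardySpace]
  change (∀ᵐ ξ : Rd d, ξ ∉ G → (𝓕 (fourierIndicator E hE hE') : L2 d) ξ = 0) ↔
    ∀ᵐ ξ : Rd d, ξ ∈ E → ξ ∈ G
  rw [fourier_fourierIndicator]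
  have h := indicatorConstLp_coeFn (p := 2) (hs := hE) (hμs := hE') (c := (1 : ℂ))
  constructor
  · intro h1
    filter_upwards [h, h1] with ξ a b hξ
    by_contra hcon
    have := b hcon
    rw [a, Set.indicator_of_mem hξ] at this
    exact one_ne_zero this
  · intro h1
    filter_upwards [h, h1] with ξ a b hξ
    rw [a, Set.indicator_of_notMem fun hE => hξ (b hE)]

theorem dilate_zpow_mem_hardySpace_iff (A : (Rd d →L[ℝ] Rd d)ˣ) (j : ℤ) (f : L2 d)
    (G : Set (Rd d)) : dilate (A ^ j) f ∈ hardySpace G ↔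
      powMap (star A) j '' Function.support ((𝓕 f : L2 d) : Rd d → ℂ) ≤ᵐ[volume] G := by
  change (∀ᵐ ξ : Rd d, ξ ∉ G → (𝓕 (dilate (A ^ j) f) : L2 d) ξ = 0) ↔
    ∀ᵐ ξ : Rd d, ξ ∈ powMap (star A) j '' Function.support ((𝓕 f : L2 d) : Rd d → ℂ) → ξ ∈ G
  have h := coeFn_fourier_dilate_zpow A j f
  rw [powMap_image]
  refine eventually_congr ?_
  filter_upwards [h] with ξ hξ
  rw [hξ, mul_eq_zero_iff_left (sqrt_absDet_ne_zero _), Set.mem_preimage, Function.mem_support]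
  tauto

theorem fourier_support_shift (t : Rd d) (f : L2 d) :
    Function.support ((𝓕 (shift t f) : L2 d) : Rd d → ℂ) =ᵐ[volume]
      Function.support ((𝓕 f : L2 d) : Rd d → ℂ) := by
  filter_upwards [coeFn_fourier_shift t f] with ξ hξ
  have hc : character t ξ ≠ 0 := by
    rw [← norm_ne_zero_iff, norm_character]
    exact one_ne_zero
  refine propext ?_
  change (𝓕 (shift t f) : L2 d) ξ ≠ 0 ↔ (𝓕 f : L2 d) ξ ≠ 0
  rw [hξ, mul_ne_zero_iff]
  exact ⟨fun h => h.2, fun h => ⟨hc, h⟩⟩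

/-- If the dilated Fourier supports of a generating set lie in `H`, then so do those of the whole
space. -/
theorem Generates.dilate_mem_hardySpace {A : (Rd d →L[ℝ] Rd d)ˣ} {V : Submodule ℂ (L2 d)}
    {𝒮 : Set (L2 d)} (h𝒮 : Generates 𝒮 V) {H : Set (Rd d)} (hH : MeasurableSet H)
    (hsup : ∀ p : 𝒮 × ℤ,
      powMap (star A) p.2 '' Function.support ((𝓕 (p.1 : L2 d) : L2 d) : Rd d → ℂ) ≤ᵐ[volume] H)
    {f : L2 d} (hf : f ∈ V) (j : ℤ) : dilate (A ^ j) f ∈ hardySpace H := by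
  let M : Submodule ℂ (L2 d) := (hardySubmodule H).comap (dilation (A ^ j)).toLinearMap
  have hM : IsClosed (M : Set (L2 d)) :=
    (isClosed_hardySpace hH).preimage (dilationₗᵢ (A ^ j)).continuous
  have hspan : Submodule.span ℂ {g : L2 d | ∃ φ ∈ 𝒮, ∃ k : Fin d → ℤ, g = shift (intVec k) φ} ≤
      M := by
    refine Submodule.span_le.2 ?_
    rintro _ ⟨φ, hφ, k, rfl⟩
    change dilate (A ^ j) (shift (intVec k) φ) ∈ hardySpace H
    rw [dilate_zpow_mem_hardySpace_iff]
    refine EventuallyLE.trans ?_ (hsup (⟨φ, hφ⟩, j))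
    rw [powMap_image, powMap_image]
    exact ((quasiMeasurePreserving_powMap (star A) (-j)).preimage_ae_eq
      (fourier_support_shift (intVec k) φ)).le
  exact (closure_minimal hspan hM) (h𝒮.2 hf)

/-! ### The scale of dilates -/

theorem iUnion_dilation_eq (A : (Rd d →L[ℝ] Rd d)ˣ) (V : Submodule ℂ (L2 d)) :
    ⋃ j : ℤ, (dilation A ^ j) '' (V : Set (L2 d)) =
      {f | ∃ j : ℤ, ∃ v ∈ V, dilate (A ^ j) v = f} := by
  ext f
  simp only [Set.mem_iUnion, Set.mem_image, dilation_zpow]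
  rfl

theorem IsRefinable.exists_dilate_eq {A : (Rd d →L[ℝ] Rd d)ˣ} {V : Submodule ℂ (L2 d)}
    (hVA : IsRefinable A V) {v : L2 d} (hv : v ∈ V) {i j : ℤ} (hij : i ≤ j) :
    ∃ w ∈ V, dilate (A ^ j) w = dilate (A ^ i) v := by
  have hnat : ∀ n : ℕ, ∃ w ∈ V, dilate (A ^ (i + n)) w = dilate (A ^ i) v := by
    intro n
    induction n with
    | zero => exact ⟨v, hv, by simp⟩
    | succ n ih =>
      obtain ⟨w, hw, hw'⟩ := ih
      obtain ⟨u, hu, hu'⟩ := hVA hw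
      refine ⟨u, hu, ?_⟩
      have hu2 : dilate A u = w := hu'
      rw [← hw', ← hu2, dilate_dilate]
      congr 1
      push_cast
      rw [← add_assoc, add_comm, zpow_add, zpow_one]
  obtain ⟨n, hn⟩ := Int.le.dest hij
  rw [← hn]
  exact hnat n

/-- Consequence: the dilate `𝒟_A^j V` is invariant under the finer lattice `A⁻ʲℤ^d`. -/
theorem shift_dilate (C : (Rd d →L[ℝ] Rd d)ˣ) (t : Rd d) (f : L2 d) :
    shift ((C⁻¹).val t) (dilate C f) = dilate C (shift t f) := by
  apply Lp.ext
  have h1 : ∀ᵐ x, shift t f x = f (x - t) := coeFn_shift t f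
  have h2 : ∀ᵐ x, dilate C f x = ((√(absDet C) : ℝ) : ℂ) * f (C.val x) := coeFn_dilate C f
  filter_upwards [coeFn_shift ((C⁻¹).val t) (dilate C f), coeFn_dilate C (shift t f),
    (quasiMeasurePreserving C).ae h1,
    (measurePreserving_sub_right volume ((C⁻¹).val t)).quasiMeasurePreserving.ae h2]
    with x a b c e
  rw [a, b, c, e, map_sub, unit_apply_inv]

/-- The closed span of the dilates of `V`. -/
def scaleClosure (A : (Rd d →L[ℝ] Rd d)ˣ) (V : Submodule ℂ (L2 d)) : Submodule ℂ (L2 d) :=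
  (⨆ j : ℤ, V.map (dilation A ^ j).toLinearMap).topologicalClosure

/-- Refinability nests the dilates, so their union is already a subspace. -/
theorem IsRefinable.coe_scaleClosure {A : (Rd d →L[ℝ] Rd d)ˣ} {V : Submodule ℂ (L2 d)}
    (hVA : IsRefinable A V) : (scaleClosure A V : Set (L2 d)) =
      closure (⋃ j : ℤ, (dilation A ^ j) '' (V : Set (L2 d))) := by
  have hmono : Monotone fun j : ℤ => V.map (dilation A ^ j).toLinearMap := by
    rintro i j hij _ ⟨v, hv, rfl⟩
    obtain ⟨w, hw, hw'⟩ := hVA.exists_dilate_eq hv hij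
    refine ⟨w, hw, ?_⟩
    change (dilation A ^ j) w = (dilation A ^ i) v
    rw [dilation_zpow, dilation_zpow, hw']
  rw [scaleClosure, Submodule.topologicalClosure_coe,
    Submodule.coe_iSup_of_directed _ hmono.directed_le]
  rfl

theorem dilate_mem_scaleClosure (A : (Rd d →L[ℝ] Rd d)ˣ) {V : Submodule ℂ (L2 d)} (j : ℤ)
    {v : L2 d} (hv : v ∈ V) : dilate (A ^ j) v ∈ scaleClosure A V := by
  refine Submodule.le_topologicalClosure _ (Submodule.mem_iSup_of_mem j ⟨v, hv, ?_⟩)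
  exact dilation_zpow A j v

/-- The Fourier transform of a function orthogonal to all dilates of `V` vanishes on the Fourier
supports of the dilates. -/
theorem ae_mul_eq_zero_of_orthogonal {A : (Rd d →L[ℝ] Rd d)ˣ} (hA : IsExpansiveDilation A.val)
    {V : Submodule ℂ (L2 d)} (hV : IsShiftInvariant V) (hVA : IsRefinable A V) {g : L2 d}
    (hg : ∀ f ∈ scaleClosure A V, inner ℂ g f = 0) {v : L2 d} (hv : v ∈ V) (j : ℤ) :
    ∀ᵐ ξ : Rd d, starRingEnd ℂ ((𝓕 g : L2 d) ξ) * (𝓕 (dilate (A ^ j) v) : L2 d) ξ = 0 := by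
  set f := dilate (A ^ j) v with hf
  set F : Rd d → ℂ := fun ξ => starRingEnd ℂ ((𝓕 g : L2 d) ξ) * (𝓕 f : L2 d) ξ with hF
  have hFint : Integrable F := by
    refine (L2.integrable_inner (𝕜 := ℂ) (𝓕 g : L2 d) (𝓕 f)).congr
      (Eventually.of_forall fun ξ => ?_)
    simp only [hF, RCLike.inner_apply]
    ring
  have hFt : ∀ t, 𝓕 F t = inner ℂ g (shift t f) := by
    intro t
    rw [inner_shift_eq_integral, Real.fourier_eq]
    refine integral_congr_ae (Eventually.of_forall fun ξ => ?_)
    simp only [character, Circle.smul_def, smul_eq_mul, real_inner_comm]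
    rfl
  have hcont : Continuous (𝓕 F) := VectorFourier.fourierIntegral_continuous
    Real.continuous_fourierChar (by simpa using! continuous_inner) hFint
  refine ae_eq_zero_of_fourier_eq_zero hFint fun t => ?_
  obtain ⟨k, hk⟩ := hA.exists_tendsto_lattice t
  have h1 := (hcont.tendsto t).comp hk
  -- For `i ≥ j` the function `f` also lies in `𝒟_A^i V`, so its shift by a point of `A⁻ⁱℤ^d` stays
  -- there and is orthogonal to `g`.
  refine tendsto_nhds_unique h1 (tendsto_const_nhds.congr' ?_)
  filter_upwards [eventually_ge_atTop j.toNat] with i hi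
  obtain ⟨w, hw, hw'⟩ := hVA.exists_dilate_eq hv (i := j) (j := i) (by lia)
  rw [Function.comp, hFt, hf, ← hw']
  have h2 : ((A⁻¹) ^ i).val = ((A ^ (i : ℤ))⁻¹).val := by rw [inv_pow, zpow_natCast]
  rw [h2, shift_dilate]
  exact (hg _ (dilate_mem_scaleClosure A _ (hV.2 w hw _))).symm

/-! ### The implications that involve the scale of dilates -/

section Implications

variable {A : (Rd d →L[ℝ] Rd d)ˣ} {V : Submodule ℂ (L2 d)} {G : Set (Rd d)} {σ : Rd d → ℝ}

/-- If `H` contains all dilated supports, then the closed space `H²_H` contains all dilates of `V`,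
hence `H²_G`. Testing with the indicators of `G ∩ B_n` yields `G ⊆ H`. -/
theorem supportsCover_of_closure_eq (hG : MeasurableSet G)
    (h1 : closure (⋃ j : ℤ, (dilation A ^ j) '' (V : Set (L2 d))) = hardySpace G)
    {𝒮 : Set (L2 d)} (h𝒮 : Generates 𝒮 V) : SupportsCover A 𝒮 G := by
  refine ⟨fun p => ?_, fun H hH hsup => ?_⟩
  · rw [← dilate_zpow_mem_hardySpace_iff, ← h1, iUnion_dilation_eq]
    exact subset_closure ⟨p.2, _, h𝒮.1 p.1.2, rfl⟩
  · have hsub : hardySpace G ⊆ hardySpace H := by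
      rw [← h1, iUnion_dilation_eq]
      refine closure_minimal ?_ (isClosed_hardySpace hH)
      rintro _ ⟨j, v, hv, rfl⟩
      exact h𝒮.dilate_mem_hardySpace hH hsup hv j
    have hn : ∀ n : ℕ, ∀ᵐ ξ : Rd d, ξ ∈ G ∩ Metric.ball 0 n → ξ ∈ H := by
      intro n
      have hE : MeasurableSet (G ∩ Metric.ball 0 n) := hG.inter measurableSet_ball
      have hE' : volume (G ∩ Metric.ball 0 (n : ℝ)) ≠ ⊤ :=
        ((measure_mono Set.inter_subset_right).trans_lt measure_ball_lt_top).ne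
      exact (fourierIndicator_mem_hardySpace_iff hE hE').1 (hsub
        ((fourierIndicator_mem_hardySpace_iff hE hE').2 Set.inter_subset_left.eventuallyLE))
    filter_upwards [ae_all_iff.2 hn] with ξ hξ hξG
    obtain ⟨n, hn⟩ := exists_nat_gt ‖ξ‖
    exact hξ n ⟨hξG, mem_ball_zero_iff.2 hn⟩

theorem closure_eq_of_supportsCover (hA : IsExpansiveDilation A.val) (hV : IsShiftInvariant V)
    (hVA : IsRefinable A V) (hG : MeasurableSet G) {𝒮 : Set (L2 d)} (h𝒮 : Generates 𝒮 V)
    (hcov : SupportsCover A 𝒮 G) :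
    closure (⋃ j : ℤ, (dilation A ^ j) '' (V : Set (L2 d))) = hardySpace G := by
  have hsub : (scaleClosure A V : Set (L2 d)) ⊆ hardySpace G := by
    rw [hVA.coe_scaleClosure, iUnion_dilation_eq]
    refine closure_minimal ?_ (isClosed_hardySpace hG)
    rintro _ ⟨j, v, hv, rfl⟩
    exact h𝒮.dilate_mem_hardySpace hG hcov.1 hv j
  rw [← hVA.coe_scaleClosure]
  refine hsub.antisymm fun f hf => ?_
  set W := scaleClosure A V with hW
  have : CompleteSpace W := (Submodule.isClosed_topologicalClosure _).completeSpace_coe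
  have hP : W.starProjection f ∈ W := Submodule.starProjection_apply_mem _ _
  set g := f - W.starProjection f with hg
  have hgG : g ∈ hardySpace G := (hardySubmodule G).sub_mem hf (hsub hP)
  have hgW : ∀ u ∈ W, inner ℂ g u = 0 := by
    intro u hu
    rw [hg, inner_sub_left, inner_starProjection_left f hu, sub_self]
  -- The minimality of the essential union is applied to the zero set of `ĝ`, so no countability of
  -- `𝒮` is needed.
  have hGH := hcov.2 {ξ | (𝓕 g : L2 d) ξ = 0}
    ((Lp.stronglyMeasurable _).measurable (measurableSet_singleton 0)) (by
      rintro ⟨φ, j⟩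
      have h1 := ae_mul_eq_zero_of_orthogonal hA hV hVA hgW (h𝒮.1 φ.2) j
      have h2 := coeFn_fourier_dilate_zpow A j (φ : L2 d)
      change powMap (star A) j '' Function.support ((𝓕 (φ : L2 d) : L2 d) : Rd d → ℂ) ≤ᵐ[volume] _
      rw [powMap_image]
      filter_upwards [h1, h2] with ξ a b hξ
      rw [b] at a
      rcases mul_eq_zero.1 a with c | c
      · exact (map_eq_zero _).1 c
      · exact absurd ((mul_eq_zero.1 c).resolve_left (sqrt_absDet_ne_zero _)) hξ)
  have hg0 : (𝓕 g : L2 d) = 0 := by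
    rw [Lp.eq_zero_iff_ae_eq_zero]
    filter_upwards [hGH, hgG] with ξ a b
    by_cases hξ : ξ ∈ G
    · exact a hξ
    · exact b hξ
  have hg00 : g = 0 := by
    rw [← norm_eq_zero, ← Lp.norm_fourier_eq, hg0, norm_zero]
  have hfP : f = W.starProjection f := sub_eq_zero.1 hg00
  rw [hfP]
  exact hP

variable [V.HasOrthogonalProjection] {ι : Type} {φ : ι → L2 d}

/-- If `σ(A*⁻ʲξ) ≠ 0` for a single `j`, some `φ̂^α` is nonzero there, which puts `ξ` in a dilated
support. -/
theorem IsSpectralData.supportsCover_of_isAbsorbing [Countable ι] (h : IsSpectralData V φ σ)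
    (hGA : powMap (star A) 1 '' G =ᵐ[volume] G) (hσG : Function.support σ ≤ᵐ[volume] G)
    (habs : IsAbsorbing (star A)⁻¹ (Function.support σ) G) :
    SupportsCover A (Set.range φ) G := by
  refine ⟨?_, fun H hH hsup => ?_⟩
  · rintro ⟨⟨_, α, rfl⟩, j⟩
    change powMap (star A) j '' Function.support ((𝓕 (φ α) : L2 d) : Rd d → ℂ) ≤ᵐ[volume] G
    rw [powMap_image]
    filter_upwards [ae_powMap (star A) h.eq_zero_iff, ae_powMap (star A) hσG,
      ae_mem_iff_of_image_ae_eq hGA] with ξ h1 h2 h3 hξ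
    refine (h3 (-j)).1 (h2 (-j) fun h0 => hξ ((h1 _).1 h0 α))
  · have hc : Countable (Set.range φ) := (Set.countable_range φ).to_subtype
    filter_upwards [ae_all_iff.2 hsup, habs, ae_powMap (star A) h.eq_zero_iff] with ξ h1 h2 h3 hξ
    obtain ⟨j, -, hj⟩ := h2 hξ
    have h4 := hj j le_rfl
    rw [powMap_inv, Function.mem_support, ne_eq, h3, not_forall] at h4
    obtain ⟨α, hα⟩ := h4
    refine h1 (⟨φ α, α, rfl⟩, (j : ℤ)) ?_
    change ξ ∈ powMap (star A) j '' Function.support ((𝓕 (φ α) : L2 d) : Rd d → ℂ)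
    rw [powMap_image]
    exact hα

theorem IsSpectralData.not_ae_eq_zero (h : IsSpectralData V φ σ) (hV0 : V ≠ ⊥) :
    ¬ ∀ᵐ ξ, σ ξ = 0 := by
  intro h0
  refine hV0 ((Submodule.eq_bot_iff _).2 fun f hf => ?_)
  have hφ : ∀ α, φ α = 0 := by
    intro α
    rw [← norm_eq_zero, ← Lp.norm_fourier_eq, norm_eq_zero, Lp.eq_zero_iff_ae_eq_zero]
    filter_upwards [h0, h.eq_zero_iff] with ξ a b using b.1 a α
  have hsum := h.tight.2 f hf
  have hs0 : ∀ t, shift t (0 : L2 d) = 0 := fun t => map_zero (Lp.compMeasurePreserving _ _)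
  simp only [hφ, hs0, inner_zero_right, norm_zero, ne_eq, OfNat.ofNat_ne_zero, not_false_eq_true,
    zero_pow] at hsum
  exact norm_eq_zero.1 ((pow_eq_zero_iff two_ne_zero).1 (hsum.unique hasSum_zero))

/-- Completeness puts `f_E` in the closure of the increasing dilates, so `𝒟_A⁻ʲ f_E` approaches `V`
and the norm of its projection tends to `‖f_E‖`, whose square is `|E|`. The rescaled central formula
identifies the squared projection norm with the integral of `σ(A*⁻ʲ·)` over `E`. -/
theorem IsSpectralData.tendsto_average (h : IsSpectralData V φ σ)
    (hA : IsExpansiveDilation A.val) (hVA : IsRefinable A V)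
    (h1 : closure (⋃ j : ℤ, (dilation A ^ j) '' (V : Set (L2 d))) = hardySpace G)
    {E : Set (Rd d)} (hEG : E ⊆ G) (hE : MeasurableSet E) (hEb : Bornology.IsBounded E)
    (hE0 : 0 < volume E) : Tendsto (fun j : ℕ => 1 / volume.real (powMap (star A) (-(j : ℤ)) '' E) *
      ∫ ξ in powMap (star A) (-(j : ℤ)) '' E, σ ξ) atTop (𝓝 1) := by
  have hE' : volume E ≠ ⊤ := hEb.measure_lt_top.ne
  have hEpos : 0 < volume.real E := ENNReal.toReal_pos hE0.ne' hE'
  set f := fourierIndicator E hE hE' with hf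
  have hfW : f ∈ closure (⋃ j : ℤ, (dilation A ^ j) '' (V : Set (L2 d))) := by
    rw [h1, fourierIndicator_mem_hardySpace_iff]
    exact hEG.eventuallyLE
  have hnorm : Tendsto (fun j : ℕ => ‖V.starProjection (dilate (A ^ j)⁻¹ f)‖) atTop (𝓝 ‖f‖) := by
    rw [Metric.tendsto_nhds]
    intro ε hε
    obtain ⟨g, hg, hgf⟩ := Metric.mem_closure_iff.1 hfW (ε / 2) (half_pos hε)
    rw [iUnion_dilation_eq] at hg
    obtain ⟨i, v, hv, rfl⟩ := hg
    filter_upwards [eventually_ge_atTop i.toNat] with j hj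
    obtain ⟨w, hw, hw'⟩ := hVA.exists_dilate_eq hv (i := i) (j := j) (by lia)
    rw [← hw', zpow_natCast, dist_eq_norm] at hgf
    set u := dilate (A ^ j)⁻¹ f with hu
    have hfu : dilate (A ^ j) u = f := dilate_inv _ _ (inv_mul_cancel _) f
    have hnu : ‖u‖ = ‖f‖ := norm_dilate _ _
    have huw : ‖u - w‖ < ε / 2 := by
      have h2 : dilate (A ^ j) (u - w) = f - dilate (A ^ j) w := by
        rw [← hfu]
        exact map_sub (dilation (A ^ j)) u w
      rwa [← h2, norm_dilate] at hgf
    have hPu : ‖V.starProjection u‖ ≤ ‖u‖ := Submodule.norm_starProjection_apply_le V u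
    have hPw : V.starProjection w = w := Submodule.starProjection_eq_self_iff.2 hw
    have hPuw : ‖V.starProjection u - w‖ ≤ ‖u - w‖ := by
      have := Submodule.norm_starProjection_apply_le V (u - w)
      rwa [map_sub, hPw] at this
    have h3 : ‖u‖ ≤ ‖u - w‖ + ‖w‖ := by simpa using norm_add_le (u - w) w
    have h4 : ‖w‖ ≤ ‖V.starProjection u - w‖ + ‖V.starProjection u‖ := by
      have := norm_sub_le (V.starProjection u) (V.starProjection u - w)
      rw [sub_sub_cancel] at this
      linarith
    rw [Real.dist_eq, abs_lt]
    constructor <;> linarith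
  have hsq := (hnorm.pow 2).const_mul (1 / volume.real E)
  rw [hf, norm_sq_fourierIndicator, one_div_mul_cancel hEpos.ne'] at hsq
  refine hsq.congr' ?_
  obtain ⟨R, hR⟩ := hEb.subset_ball (0 : Rd d)
  -- For large `j` the set `A*⁻ʲE` fits into the ball of radius `1/2` required by that formula.
  filter_upwards [eventually_powMap_mem_ball hA.tendsto_star_inv_pow R (half_pos one_pos)]
    with j hj
  rw [average_powMap_image _ _ hE]
  congr 1
  have hstar : star (A ^ j) = star A ^ j := star_pow A j
  have hsub : (star (A ^ j)).val ⁻¹' E ⊆ Metric.ball 0 (1 / 2) := by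
    intro ξ hξ
    have h2 := hj _ (hR hξ)
    rw [powMap_neg_natCast, hstar, inv_pow, unit_inv_apply] at h2
    exact h2
  have hint := h.lintegral_comp_eq (A ^ j) hE hE' hsub
  have hpow : ∀ ξ, ((star (A ^ j))⁻¹).val ξ = powMap (star A) (-(j : ℤ)) ξ := by
    intro ξ
    rw [powMap_neg_natCast, hstar, inv_pow]
  simp_rw [hpow] at hint
  rw [integral_eq_lintegral_of_nonneg_ae, hint, ENNReal.toReal_ofReal (sq_nonneg _)]
  · refine ae_restrict_of_ae ?_
    filter_upwards [ae_powMap (star A) h.mem_Icc] with ξ hξ using (hξ _).1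
  · exact (h.aemeasurable.comp_quasiMeasurePreserving
      (quasiMeasurePreserving_powMap (star A) _)).aestronglyMeasurable.restrict

end Implications

end ShiftInv

end

/-! ### Assembly of the equivalences -/

theorem mainTheorem1 {d : ℕ} (A : (ShiftInv.Rd d →L[ℝ] ShiftInv.Rd d)ˣ)
    (hA : ShiftInv.IsExpansiveDilation (A : ShiftInv.Rd d →L[ℝ] ShiftInv.Rd d))
    (V : Submodule ℂ (ShiftInv.L2 d)) (hV : ShiftInv.IsShiftInvariant V)
    (hVA : ShiftInv.IsRefinable A V) (hV0 : V ≠ ⊥)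
    (G : Set (ShiftInv.Rd d)) (hG : MeasurableSet G)
    (hGA : ShiftInv.powMap (star A) 1 '' G =ᵐ[volume] G) (hG0 : 0 < volume G) :
    (∃ σ : ShiftInv.Rd d → ℝ, ShiftInv.IsSpectralFunction V σ) ∧
    ∀ σ : ShiftInv.Rd d → ℝ, ShiftInv.IsSpectralFunction V σ →
      Function.support σ ≤ᵐ[volume] G →
      List.TFAE [
        -- completeness
        closure (⋃ j : ℤ, (ShiftInv.dilation A ^ j) '' (V : Set (ShiftInv.L2 d))) =
          ShiftInv.hardySpace G,
        -- the dilated Fourier supports of every generating set cover `G`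
        ∀ 𝒮 : Set (ShiftInv.L2 d), ShiftInv.Generates 𝒮 V → ShiftInv.SupportsCover A 𝒮 G,
        -- the dilated Fourier supports of some generating set cover `G`
        ∃ 𝒮 : Set (ShiftInv.L2 d), ShiftInv.Generates 𝒮 V ∧ ShiftInv.SupportsCover A 𝒮 G,
        -- averages of the spectral function
        ∀ E : Set (ShiftInv.Rd d), E ⊆ G → MeasurableSet E → Bornology.IsBounded E →
          0 < volume E →
          Tendsto (fun j : ℕ =>
            1 / volume.real (ShiftInv.powMap (star A) (-(j : ℤ)) '' E) *
              ∫ ξ in ShiftInv.powMap (star A) (-(j : ℤ)) '' E, σ ξ) atTop (𝓝 1),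
        -- absorption
        ShiftInv.IsAbsorbing (star A)⁻¹ (Function.support σ) G,
        -- positive limit
        ∀ᵐ ξ ∂(volume : Measure (ShiftInv.Rd d)), ξ ∈ G → ∃ l : ℝ, 0 < l ∧
          Tendsto (fun j : ℕ => σ (ShiftInv.powMap (star A) (-(j : ℤ)) ξ)) atTop (𝓝 l),
        -- limit one
        ∀ᵐ ξ ∂(volume : Measure (ShiftInv.Rd d)), ξ ∈ G →
          Tendsto (fun j : ℕ => σ (ShiftInv.powMap (star A) (-(j : ℤ)) ξ)) atTop (𝓝 1),
        -- locally nonzero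
        ShiftInv.IsLocallyNonzero G (star A) σ,
        -- approximate continuity with the value one at the origin
        ShiftInv.IsApproxContinuous G (star A) (Function.update σ 0 1)] := by
  have hcomplete : CompleteSpace V := hV.1.completeSpace_coe
  refine ⟨ShiftInv.exists_isSpectralFunction hV, fun σ hσ hσG => ?_⟩
  obtain ⟨ι, hι, φ, hdata⟩ := hσ.exists_isSpectralData hV
  have horb : ShiftInv.IsOrbitMonotone (star A) G σ :=
    ⟨hA.tendsto_star_inv_pow, hG, hGA, hG0, hdata.aemeasurable, hdata.mem_Icc, hdata.le_comp hVA⟩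
  -- For `d = 0` the origin is the whole space, and `V ≠ ⊥` forces `σ 0 ≠ 0`; otherwise the origin
  -- is null.
  have hzero : σ 0 ≠ 0 ∨ volume {(0 : ShiftInv.Rd d)} = 0 := by
    rcases Nat.eq_zero_or_pos d with rfl | hd
    · refine Or.inl fun h0 => hdata.not_ae_eq_zero hV0 (Eventually.of_forall fun ξ => ?_)
      rw [Subsingleton.elim ξ 0, h0]
    · have : Nonempty (Fin d) := ⟨⟨0, hd⟩⟩
      exact Or.inr (measure_singleton 0)
  -- A positive limit is upgraded to limit one only through absorption, the cover by supports,
  -- completeness and averages.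
  tfae_have 1 → 2 := fun h1 𝒮 h𝒮 => ShiftInv.supportsCover_of_closure_eq hG h1 h𝒮
  tfae_have 2 → 3 := fun h2 => ⟨_, hdata.tight.generates hV, h2 _ (hdata.tight.generates hV)⟩
  tfae_have 3 → 1 := fun ⟨𝒮, h𝒮, hcov⟩ =>
    ShiftInv.closure_eq_of_supportsCover hA hV hVA hG h𝒮 hcov
  tfae_have 1 → 4 := fun h1 E hEG hE hEb hE0 => hdata.tendsto_average hA hVA h1 hEG hE hEb hE0
  tfae_have 4 → 7 := horb.tendsto_one_of_average
  tfae_have 7 → 6 := fun h7 => by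
    filter_upwards [h7] with ξ hξ hG using ⟨1, one_pos, hξ hG⟩
  tfae_have 6 → 5 := fun h6 => by
    filter_upwards [h6] with ξ hξ hG
    obtain ⟨l, hl, hlim⟩ := hξ hG
    obtain ⟨j₀, hj₀⟩ := eventually_atTop.1 (hlim.eventually_ne hl.ne')
    refine ⟨j₀ + 1, Nat.succ_pos _, fun j hj => ?_⟩
    rw [ShiftInv.powMap_inv]
    exact hj₀ j (by lia)
  tfae_have 5 → 3 := fun h5 =>
    ⟨_, hdata.tight.generates hV, hdata.supportsCover_of_isAbsorbing hGA hσG h5⟩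
  tfae_have 5 → 8 := horb.isLocallyNonzero_of_isAbsorbing
  tfae_have 8 → 5 := horb.isAbsorbing_of_isLocallyNonzero
  tfae_have 7 → 9 := horb.isApproxContinuous
  tfae_have 9 → 8 := horb.isLocallyNonzero_of_isApproxContinuous hzero
  tfae_finish
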